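/- **Model.** A matroid intersection instance consists of two matroids $M_1=(N,\mathcal I_1)$, $M_2=(N,\mathcal I_2)$ on a common finite ground set $N$ with $n$ elements; $r$ denotes the maximum cardinality of a common independent set, i.e. of a set in $\mathcal I_1\cap\mathcal I_2$. The matroids are accessed through oracles, either independence oracles (is $S\in\mathcal I_i$?) or rank oracles (what is $\mathrm{rk}_i(S)$?), and only oracle queries are counted. In the weighted problem there are also explicitly given weights $w:N\to\mathbb R_{>0}$, and $W=\max_e w(e)/\min_e w(e)$ (if $N=\emptyset$, read $\log W$ as $0$). A set $S$ is an $\alpha$-approximate maximum cardinality (weight) common independent set if $S\in\mathcal I_1\cap\mathcal I_2$ and $|S|\ge\alpha|I|$ (resp. $w(S)\ge\alpha\, w(I)$) for all $I\in\mathcal I_1\cap\mathcal I_2$. A (possibly randomized) algorithm is a probability distribution on deterministic query algorithms (decision trees); it is $\alpha$-approximate with success probability $p$ if on every instance its output is $\alpha$-approximate with probability at least $p$, and query bounds hold for all random choices. It is deterministic if the distribution is a point mass. For $\varepsilon>0$ put $\gamma_\varepsilon=\lceil(1/\varepsilon)^{1/\varepsilon}\rceil$. **Theorem.** There is an absolute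 constant $C\ge 1$ such that the following holds for all $\varepsilon>0$, $\alpha\in(0,1]$, $p\in[2/3,1]$, both kinds of oracle, and every $T_u:\mathbb N\times\mathbb N\to\mathbb R$ that is nondecreasing in each argument. Write $\gamma=\gamma_{\varepsilon/C}$, so that $\gamma=(1/\varepsilon)^{O(1/\varepsilon)}$ for $\varepsilon\le 1/2$. Let $\mathcal A_u$ be an algorithm that computes, with success probability $p$, an $\alpha$-approximate maximum cardinality common independent set using at most $T_u(n,r)$ oracle queries. Then there is an algorithm $\mathcal A_w$, using the same kind of oracle, that computes, with success probability $p$, an $\alpha(1-\varepsilon)$-approximate maximum weight common independent set using at most $$C\Bigl(\gamma\, T_u(n\gamma,r\gamma)+\frac{\gamma^3 r}{\varepsilon^3}\Bigr)(1+\log W)$$ oracle queries. If moreover $T_u$ grows at least linearly, in the sense that $k\,T_u(n,r)\le T_u(kn,kr)$ for all integers $k\ge1$ and $n,r\ge0$, then the same $\mathcal A_w$ makes at most $$C\Bigl(T_u(n\gamma,r\gamma)+\frac{\gamma^3 r}{\varepsilon^3}\Bigr)(1+\log W)$$ oracle queries. If $\mathcal A_u$ is deterministic, then so is $\mathcal A_w$.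 -/

import Mathlib

/-- The two standard ways of accessing a matroid: through an independence oracle or through a
rank oracle. -/
inductive OracleKind where
  | independence
  | rank

/-- Independence queries are answered by yes or no, rank queries by a natural number. -/
def OracleKind.Answer : OracleKind → Type
  | .independence => Bool
  | .rank => ℕ

open scoped Classical in
/-- The answer of the oracle of the matroid `M` to the query `S`: whether `S` is independent, or
the rank of `S` (the largest size of an independent subset of `S`). -/
noncomputable def OracleKind.answer {V : Type} :
    (o : OracleKind) → Matroid V → Finset V → o.Answer
  | .independence, M, S => (decide (M.Indep (S : Set V)) : Bool)
  | .rank, M, S => ((M.eRk (S : Set V)).toNat : ℕ)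

/-- A deterministic query algorithm (decision tree) for a pair of matroids on the ground set `V`.
It either stops with an output, or it asks the oracle of one of the two matroids (`i = 0, 1`) a
set `S` and goes on depending on the answer. -/
inductive QueryTree (V : Type) (o : OracleKind) where
  | output (S : Finset V) : QueryTree V o
  | query (i : Fin 2) (S : Finset V) (next : o.Answer → QueryTree V o) : QueryTree V o

namespace QueryTree

variable {V : Type} {o : OracleKind}

/-- The output of the algorithm on the pair of matroids `M 0`, `M 1`. -/
noncomputable def run (M : Fin 2 → Matroid V) : QueryTree V o → Finset V
  | .output S => S
  | .query i S next => run M (next (o.answer (M i) S))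

/-- The number of oracle queries made on the pair of matroids `M 0`, `M 1`. -/
noncomputable def numQueries (M : Fin 2 → Matroid V) : QueryTree V o → ℕ
  | .output _ => 0
  | .query i S next => numQueries M (next (o.answer (M i) S)) + 1

end QueryTree

/-- A randomized query algorithm on the ground set `V`: a probability distribution on deterministic
ones. -/
abbrev RandQueryAlg (V : Type) (o : OracleKind) := PMF (QueryTree V o)

/-- The algorithm uses no randomness. -/
def RandQueryAlg.IsDeterministic {V : Type} {o : OracleKind} (A : RandQueryAlg V o) : Prop :=
  ∃ t : QueryTree V o, A = PMF.pure t

/-- A matroid intersection instance with ground set `V`. -/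
def IsInstance {V : Type} (M : Fin 2 → Matroid V) : Prop :=
  ∀ i, (M i).E = Set.univ

/-- `S` is independent in both matroids. -/
def IsCommonIndep {V : Type} (M : Fin 2 → Matroid V) (S : Finset V) : Prop :=
  ∀ i, (M i).Indep (S : Set V)

open scoped Classical in
/-- The maximum cardinality of a common independent set. -/
noncomputable def commonRank {V : Type} [Fintype V] (M : Fin 2 → Matroid V) : ℕ :=
  (Finset.univ.filter fun S : Finset V => IsCommonIndep M S).sup Finset.card

/-- `S` is an `α`-approximate maximum cardinality common independent set. -/
def IsApproxMaxCard {V : Type} (α : ℝ) (M : Fin 2 → Matroid V) (S : Finset V) : Prop :=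
  IsCommonIndep M S ∧
    ∀ I : Finset V, IsCommonIndep M I → α * (I.card : ℝ) ≤ (S.card : ℝ)

/-- `S` is an `α`-approximate maximum weight common independent set for the weights `w`. -/
def IsApproxMaxWeight {V : Type} (α : ℝ) (M : Fin 2 → Matroid V) (w : V → ℝ)
    (S : Finset V) : Prop :=
  IsCommonIndep M S ∧
    ∀ I : Finset V, IsCommonIndep M I → α * ∑ e ∈ I, w e ≤ ∑ e ∈ S, w e

/-- The ratio of the largest to the smallest weight. (On the empty ground set it is `0`, with
logarithm `0`.) -/
noncomputable def weightRatio {V : Type} (w : V → ℝ) : ℝ :=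
  (⨆ e, w e) / (⨅ e, w e)

/-- An algorithm for unweighted matroid intersection: for every number `n` of elements, a
(randomized) query algorithm on the ground set `Fin n`. -/
abbrev UnweightedAlg (o : OracleKind) := (n : ℕ) → RandQueryAlg (Fin n) o

/-- An algorithm for weighted matroid intersection. The weights are given explicitly, the matroids
through their oracles. -/
abbrev WeightedAlg (o : OracleKind) := (n : ℕ) → (Fin n → ℝ) → RandQueryAlg (Fin n) o

/-- On every instance, with probability at least `p`, the output is an `α`-approximate maximum
cardinality common independent set. -/
def UnweightedAlg.Approximates {o : OracleKind} (A : UnweightedAlg o) (α : ℝ)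
    (p : ENNReal) : Prop :=
  ∀ (n : ℕ) (M : Fin 2 → Matroid (Fin n)), IsInstance M →
    p ≤ (A n).toOuterMeasure {t | IsApproxMaxCard α M (t.run M)}

/-- On every instance with positive weights, with probability at least `p`, the output is an
`α`-approximate maximum weight common independent set. -/
def WeightedAlg.Approximates {o : OracleKind} (A : WeightedAlg o) (α : ℝ)
    (p : ENNReal) : Prop :=
  ∀ (n : ℕ) (w : Fin n → ℝ) (M : Fin 2 → Matroid (Fin n)), (∀ e, 0 < w e) → IsInstance M →
    p ≤ (A n w).toOuterMeasure {t | IsApproxMaxWeight α M w (t.run M)}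

/-- For all random choices, the algorithm makes at most `T n r` queries on every instance with `n`
elements whose largest common independent set has size `r`. -/
def UnweightedAlg.QueriesAtMost {o : OracleKind} (A : UnweightedAlg o) (T : ℕ → ℕ → ℝ) : Prop :=
  ∀ (n : ℕ) (M : Fin 2 → Matroid (Fin n)), IsInstance M →
    ∀ t ∈ (A n).support, (t.numQueries M : ℝ) ≤ T n (commonRank M)

/-- For all random choices, the algorithm makes at most `B n r W` queries on every instance with
`n` elements whose largest common independent set has size `r` and whose weights are positive and
have ratio `W`. -/
def WeightedAlg.QueriesAtMost {o : OracleKind} (A : WeightedAlg o) (B : ℕ → ℕ → ℝ → ℝ) : Prop :=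
  ∀ (n : ℕ) (w : Fin n → ℝ) (M : Fin 2 → Matroid (Fin n)), (∀ e, 0 < w e) → IsInstance M →
    ∀ t ∈ (A n w).support, (t.numQueries M : ℝ) ≤ B n (commonRank M) (weightRatio w)

/-- `γ_ε = ⌈(1/ε)^(1/ε)⌉`. -/
noncomputable def gammaEps (ε : ℝ) : ℕ :=
  ⌈(1 / ε) ^ (1 / ε)⌉₊

/-! Weights are turned into copies. For integer weights `w e ≤ L`, take a direct sum of `L` copies
of each matroid and give `e` exactly `w e` copies, the `k`-th one lying in layer `k` for the first
matroid and in layer `w e - 1 - k` for the second (`unfoldPair`). A common independent set `I`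
yields one of size `w(I)` (`exists_copies`). The converse is approximate weak duality: split `q * w
e` into `x e + y e` up to one. Each copy then receives at least `q - 1` from the pieces of `x` and
`y` belonging to its two layers (`le_min_sub_add_min_sub`), and domination layer by layer bounds any
common independent set `T` of copies (`card_copies_le`). The splitting comes from an auction: the
first matroid offers a basis of largest utility, the second keeps a basis of largest price, and
rejected elements become dearer by one. Prices are bounded, so an average round rejects few
elements, and the best round gives a common independent set of weight almost `|T|` inside the image
of `T` (`refold_spec`). Only that image takes part, and `|T| ≤ 2 * L * r`, so this phase costs a
multiple of `r` and not of `n`.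

For real weights put `N = ⌈6 / ε⌉` and cut the weights into bands of ratio `4 * N`. Deleting every
`N`-th band costs a fraction `1 / N` for a suitable shift (`exists_shift`). The surviving classes
have a spread bounded in terms of `N`, so after rounding `L = numCopies N` copies suffice.
Consecutive classes are a factor `4 * N` apart, so merging their solutions greedily from heavy to
light loses little (`mergeInto_spec`, `mergeClasses_spec`).

The number of classes grows with `log W`, which rules out a union bound over failures. Instead `N +
1` query trees are sampled once and reused in all classes; this is possible because surplus copies
are loops, so that every class lives on the same `n * L` elements. Markov's inequality for the
weight of the unsolved classes (`unsolved_weight_le`) bounds the failure probability by `N * (1 - p)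
^ (N + 1) ≤ 1 - p`, so the success probability remains `p`. -/

/-! ### Query programs -/

/-- A query algorithm for a pair of matroids on `V` that returns a value of type `β`. -/
inductive QueryProgram (V : Type) (o : OracleKind) (β : Type) where
  | ret (b : β) : QueryProgram V o β
  | query (i : Fin 2) (S : Finset V) (next : o.Answer → QueryProgram V o β) : QueryProgram V o β

namespace QueryProgram

variable {V : Type} {o : OracleKind} {β β' : Type}

/-- Sequential composition. -/
def bind : QueryProgram V o β → (β → QueryProgram V o β') → QueryProgram V o β'
  | .ret b, f => f b
  | .query i S next, f => .query i S fun a => (next a).bind f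

/-- The value returned on the pair of matroids `M`. -/
noncomputable def run (M : Fin 2 → Matroid V) : QueryProgram V o β → β
  | .ret b => b
  | .query i S next => run M (next (o.answer (M i) S))

/-- The number of queries made on the pair of matroids `M`. -/
noncomputable def cost (M : Fin 2 → Matroid V) : QueryProgram V o β → ℕ
  | .ret _ => 0
  | .query i S next => cost M (next (o.answer (M i) S)) + 1

@[simp] lemma run_ret (M : Fin 2 → Matroid V) (b : β) :
    (ret b : QueryProgram V o β).run M = b := rfl

@[simp] lemma cost_ret (M : Fin 2 → Matroid V) (b : β) :
    (ret b : QueryProgram V o β).cost M = 0 := rfl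

@[simp] lemma run_query (M : Fin 2 → Matroid V) (i : Fin 2) (S : Finset V)
    (next : o.Answer → QueryProgram V o β) :
    (query i S next).run M = (next (o.answer (M i) S)).run M := rfl

@[simp] lemma cost_query (M : Fin 2 → Matroid V) (i : Fin 2) (S : Finset V)
    (next : o.Answer → QueryProgram V o β) :
    (query i S next).cost M = (next (o.answer (M i) S)).cost M + 1 := rfl

@[simp] lemma run_bind (M : Fin 2 → Matroid V) (P : QueryProgram V o β)
    (f : β → QueryProgram V o β') : (P.bind f).run M = (f (P.run M)).run M := by
  induction P with
  | ret b => rfl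
  | query i S next ih => simp [bind, ih]

@[simp] lemma cost_bind (M : Fin 2 → Matroid V) (P : QueryProgram V o β)
    (f : β → QueryProgram V o β') : (P.bind f).cost M = P.cost M + (f (P.run M)).cost M := by
  induction P with
  | ret b => simp [bind]
  | query i S next ih => simp [bind, ih]; omega

/-- A query tree as a query program. -/
def ofTree : QueryTree V o → QueryProgram V o (Finset V)
  | .output S => .ret S
  | .query i S next => .query i S fun a => ofTree (next a)

/-- A query program with set output as a query tree. -/
def toTree : QueryProgram V o (Finset V) → QueryTree V o
  | .ret S => .output S
  | .query i S next => .query i S fun a => toTree (next a)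

@[simp] lemma run_ofTree (M : Fin 2 → Matroid V) (t : QueryTree V o) :
    (ofTree t).run M = t.run M := by
  induction t with
  | output S => rfl
  | query i S next ih => simp [ofTree, QueryTree.run, ih]

@[simp] lemma cost_ofTree (M : Fin 2 → Matroid V) (t : QueryTree V o) :
    (ofTree t).cost M = t.numQueries M := by
  induction t with
  | output S => rfl
  | query i S next ih => simp [ofTree, QueryTree.numQueries, ih]

@[simp] lemma run_toTree (M : Fin 2 → Matroid V) (P : QueryProgram V o (Finset V)) :
    P.toTree.run M = P.run M := by
  induction P with
  | ret S => rfl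
  | query i S next ih => simp [toTree, QueryTree.run, ih]

@[simp] lemma numQueries_toTree (M : Fin 2 → Matroid V) (P : QueryProgram V o (Finset V)) :
    P.toTree.numQueries M = P.cost M := by
  induction P with
  | ret S => rfl
  | query i S next ih => simp [toTree, QueryTree.numQueries, ih]

/-- Run a program for each element of a list and collect the results. -/
def mapList {ι : Type} (f : ι → QueryProgram V o β) : List ι → QueryProgram V o (List β)
  | [] => .ret []
  | x :: l => (f x).bind fun b => (mapList f l).bind fun bs => .ret (b :: bs)

@[simp] lemma run_mapList {ι : Type} (M : Fin 2 → Matroid V) (f : ι → QueryProgram V o β)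
    (l : List ι) : (mapList f l).run M = l.map fun x => (f x).run M := by
  induction l with
  | nil => rfl
  | cons x l ih => simp [mapList, ih]

lemma cost_mapList {ι : Type} (M : Fin 2 → Matroid V) (f : ι → QueryProgram V o β)
    (l : List ι) : (mapList f l).cost M = (l.map fun x => (f x).cost M).sum := by
  induction l with
  | nil => rfl
  | cons x l ih => simp [mapList, ih]

end QueryProgram

/-! ### Independence tests and greedy bases -/

/-- Whether an oracle answer certifies that the queried set is independent. -/
def OracleKind.saysIndep {V : Type} : (o : OracleKind) → Finset V → o.Answer → Bool
  | .independence, _, a => a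
  | .rank, S, a => Nat.beq a S.card

/-- A finite set is independent exactly when its rank equals its size. Finiteness also ensures that
`toNat` loses no information. -/
lemma OracleKind.saysIndep_answer {V : Type} (o : OracleKind) (M : Matroid V) (S : Finset V) :
    o.saysIndep S (o.answer M S) = true ↔ M.Indep (S : Set V) := by
  cases o with
  | independence =>
    classical
    exact decide_eq_true_iff
  | rank =>
    have h : M.eRk (S : Set V) ≠ ⊤ :=
      ((M.eRk_le_encard _).trans_lt (by simp [Set.encard_coe_eq_coe_finsetCard])).ne
    rw [M.indep_iff_eRk_eq_encard_of_finite S.finite_toSet, Set.encard_coe_eq_coe_finsetCard]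
    refine Iff.trans (b := (M.eRk (S : Set V)).toNat = S.card) ?_ ⟨fun h' => ?_, fun h' => ?_⟩
    · exact Nat.beq_eq ▸ Iff.rfl
    · rw [← ENat.natCast_toNat h, h']
    · rw [h']; rfl

namespace QueryProgram

variable {V : Type} {o : OracleKind}

/-- Test whether `S` is independent in the matroid `i`. -/
def indepTest (i : Fin 2) (S : Finset V) : QueryProgram V o Bool :=
  .query i S fun a => .ret (o.saysIndep S a)

lemma run_indepTest (M : Fin 2 → Matroid V) (i : Fin 2) (S : Finset V) :
    (indepTest i S : QueryProgram V o Bool).run M = true ↔ (M i).Indep (S : Set V) :=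
  o.saysIndep_answer _ _

@[simp] lemma cost_indepTest (M : Fin 2 → Matroid V) (i : Fin 2) (S : Finset V) :
    (indepTest i S : QueryProgram V o Bool).cost M = 1 := rfl

/-- Test whether `S` is a common independent set. -/
def commonIndepTest (S : Finset V) : QueryProgram V o Bool :=
  (indepTest 0 S).bind fun b => (indepTest 1 S).bind fun c => .ret (b && c)

lemma run_commonIndepTest (M : Fin 2 → Matroid V) (S : Finset V) :
    (commonIndepTest S : QueryProgram V o Bool).run M = true ↔ IsCommonIndep M S := by
  simp [commonIndepTest, IsCommonIndep, Fin.forall_fin_two, run_indepTest]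

@[simp] lemma cost_commonIndepTest (M : Fin 2 → Matroid V) (S : Finset V) :
    (commonIndepTest S : QueryProgram V o Bool).cost M = 2 := rfl

/-- The elements of `X` in the order of decreasing keys. -/
noncomputable def sortedBy (key : V → ℕ) (X : Finset V) : List V :=
  X.toList.insertionSort fun a b => key b ≤ key a

lemma mem_sortedBy (key : V → ℕ) (X : Finset V) (e : V) : e ∈ sortedBy key X ↔ e ∈ X := by
  simp [sortedBy, List.mem_insertionSort]

lemma length_sortedBy (key : V → ℕ) (X : Finset V) : (sortedBy key X).length = X.card := by
  simp [sortedBy, List.length_insertionSort]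

lemma pairwise_sortedBy (key : V → ℕ) (X : Finset V) :
    (sortedBy key X).Pairwise fun a b => key b ≤ key a := by
  have : Std.Total fun a b : V => key b ≤ key a := ⟨fun a b => le_total _ _⟩
  have : IsTrans V fun a b : V => key b ≤ key a := ⟨fun a b c h h' => h'.trans h⟩
  exact List.pairwise_insertionSort _ _

variable [DecidableEq V]

/-- Go through a list and add every element that passes the test. -/
def greedyWith (test : Finset V → QueryProgram V o Bool) :
    List V → Finset V → QueryProgram V o (Finset V)
  | [], B => .ret B
  | e :: l, B => (test (insert e B)).bind fun b => greedyWith test l (if b then insert e B else B)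

lemma cost_greedyWith (M : Fin 2 → Matroid V) (test : Finset V → QueryProgram V o Bool) (c : ℕ)
    (hc : ∀ S, (test S).cost M = c) (l : List V) (B : Finset V) :
    (greedyWith test l B).cost M = c * l.length := by
  induction l generalizing B with
  | nil => rfl
  | cons e l ih => simp [greedyWith, ih, hc]; ring

lemma subset_run_greedyWith (M : Fin 2 → Matroid V) (test : Finset V → QueryProgram V o Bool)
    (l : List V) (B : Finset V) : B ⊆ (greedyWith test l B).run M := by
  induction l generalizing B with
  | nil => exact subset_rfl
  | cons e l ih =>
    simp only [greedyWith, run_bind]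
    refine subset_trans ?_ (ih _)
    split_ifs
    · exact Finset.subset_insert _ _
    · exact subset_rfl

lemma run_greedyWith_subset (M : Fin 2 → Matroid V) (test : Finset V → QueryProgram V o Bool)
    (l : List V) (B : Finset V) : (greedyWith test l B).run M ⊆ B ∪ l.toFinset := by
  induction l generalizing B with
  | nil => simp [greedyWith]
  | cons e l ih =>
    simp only [greedyWith, run_bind]
    refine (ih _).trans ?_
    intro x hx
    split_ifs at hx <;> simp at hx ⊢ <;> tauto

lemma run_greedyWith_invariant (M : Fin 2 → Matroid V) (test : Finset V → QueryProgram V o Bool)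
    (p : Finset V → Prop) (hp : ∀ S, (test S).run M = true → p S) (l : List V) (B : Finset V)
    (hB : p B) : p ((greedyWith test l B).run M) := by
  induction l generalizing B with
  | nil => exact hB
  | cons e l ih =>
    simp only [greedyWith, run_bind]
    apply ih
    split_ifs with h
    · exact hp _ h
    · exact hB

/-- Greedy processing of a sorted list gives an independent set that dominates the list. -/
lemma greedyWith_indepTest_spec (M : Fin 2 → Matroid V) (i : Fin 2) (hE : (M i).E = Set.univ)
    (key : V → ℕ) (l : List V) (hl : l.Pairwise fun a b => key b ≤ key a) (B : Finset V)
    (hB : (M i).Indep (B : Set V)) (hBl : ∀ f ∈ B, ∀ e ∈ l, key e ≤ key f) :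
    ∀ e ∈ l, e ∈ (M i).closure
      {f | f ∈ (greedyWith (indepTest i) l B : QueryProgram V o _).run M ∧ key e ≤ key f} := by
  induction l generalizing B with
  | nil => simp
  | cons a l ih =>
    rw [List.pairwise_cons] at hl
    set b := (indepTest i (insert a B) : QueryProgram V o Bool).run M with hb
    have hsub := subset_run_greedyWith (o := o) M (indepTest i) l (if b then insert a B else B)
    have hB' : (M i).Indep ((if b then insert a B else B : Finset V) : Set V) := by
      split_ifs with h
      · exact (run_indepTest M i _).1 h
      · exact hB
    simp only [greedyWith, run_bind, ← hb]
    intro e he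
    rcases List.mem_cons.1 he with rfl | he
    · by_cases h : b = true
      · apply (M i).mem_closure_of_mem'
        exact ⟨hsub (by simp [h]), le_rfl⟩
      -- A refused element is spanned by the current set, whose members precede it in the sorted
      -- order and hence have keys at least as large.
      · have h1 : ¬ (M i).Indep (insert e (B : Set V)) := by
          rw [hb, run_indepTest, Finset.coe_insert] at h
          exact h
        have h2 : e ∈ (M i).closure (B : Set V) := by
          by_contra h3
          exact h1 ((Matroid.Indep.notMem_closure_iff hB (by simp [hE])).1 h3).1
        refine (M i).closure_subset_closure ?_ h2
        intro f hf
        exact ⟨hsub (by simpa [h] using hf), hBl f hf e (by simp)⟩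
    · refine ih hl.2 _ hB' ?_ e he
      intro f hf e' he'
      split_ifs at hf with h
      · rcases Finset.mem_insert.1 hf with rfl | hf
        · exact hl.1 _ he'
        · exact hBl f hf e' (by simp [he'])
      · exact hBl f hf e' (by simp [he'])

/-- A basis of `X` in the matroid `i` that is greedy for the keys. -/
noncomputable def greedyBasis (i : Fin 2) (key : V → ℕ) (X : Finset V) :
    QueryProgram V o (Finset V) :=
  greedyWith (indepTest i) (sortedBy key X) ∅

lemma cost_greedyBasis (M : Fin 2 → Matroid V) (i : Fin 2) (key : V → ℕ) (X : Finset V) :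
    (greedyBasis i key X : QueryProgram V o _).cost M = X.card := by
  rw [greedyBasis, cost_greedyWith M _ 1 (fun _ => rfl), length_sortedBy, one_mul]

lemma greedyBasis_subset (M : Fin 2 → Matroid V) (i : Fin 2) (key : V → ℕ) (X : Finset V) :
    (greedyBasis i key X : QueryProgram V o _).run M ⊆ X := by
  intro e he
  have := run_greedyWith_subset M _ _ _ he
  simpa [mem_sortedBy] using this

lemma greedyBasis_indep (M : Fin 2 → Matroid V) (i : Fin 2) (key : V → ℕ) (X : Finset V) :
    (M i).Indep (((greedyBasis i key X : QueryProgram V o (Finset V)).run M : Finset V) : Set V) :=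
  run_greedyWith_invariant M _ (fun S => (M i).Indep (S : Set V))
    (fun S h => (run_indepTest M i S).1 h) _ _ (by simp)

lemma mem_closure_greedyBasis (M : Fin 2 → Matroid V) (i : Fin 2) (hE : (M i).E = Set.univ)
    (key : V → ℕ) (X : Finset V) {e : V} (he : e ∈ X) :
    e ∈ (M i).closure
      {f | f ∈ (greedyBasis i key X : QueryProgram V o _).run M ∧ key e ≤ key f} :=
  greedyWith_indepTest_spec M i hE key _ (pairwise_sortedBy key X) ∅ (by simp) (by simp) e
    ((mem_sortedBy _ _ _).2 he)

end QueryProgram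

/-! ### Domination in matroids -/

/-- If every element of the independent set `A` with positive value is spanned by the elements of
`B` with at least the same value, then the total value of `A` is at most that of `B`. -/
lemma Matroid.sum_le_sum_of_dominated {V : Type} (M : Matroid V) (g g' : V → ℕ)
    (A B : Finset V) (hA : M.Indep (A : Set V))
    (h : ∀ e ∈ A, 0 < g e → e ∈ M.closure {f | f ∈ B ∧ g e ≤ g' f}) :
    ∑ e ∈ A, g e ≤ ∑ e ∈ B, g' e := by
  classical
  have key : ∀ (g : V → ℕ) (T : Finset V) (m : ℕ), (∀ e ∈ T, g e ≤ m) →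
      ∑ e ∈ T, g e = ∑ t ∈ Finset.Icc 1 m, (T.filter fun e => t ≤ g e).card := by
    intro g T m hT
    simp_rw [Finset.card_filter]
    rw [Finset.sum_comm]
    refine Finset.sum_congr rfl fun e he => ?_
    rw [← Finset.card_filter]
    have : (Finset.Icc 1 m).filter (fun t => t ≤ g e) = Finset.Icc 1 (g e) := by
      ext t
      have := hT e he
      simp only [Finset.mem_filter, Finset.mem_Icc]
      omega
    simp [this]
  -- Both totals are sums of the sizes of level sets, so it suffices to compare level sets. The one
  -- of `A` is independent and spanned by the one of `B`.
  rw [key g A (A.sup g + B.sup g') fun e he => (Finset.le_sup he).trans (Nat.le_add_right _ _),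
    key g' B (A.sup g + B.sup g') fun e he => (Finset.le_sup he).trans (Nat.le_add_left _ _)]
  refine Finset.sum_le_sum fun t ht => ?_
  have ht : 1 ≤ t := (Finset.mem_Icc.1 ht).1
  have h1 : ((A.filter fun e => t ≤ g e : Finset V) : Set V) ⊆
      M.closure ((B.filter fun e => t ≤ g' e : Finset V) : Set V) := by
    intro e he
    have he : e ∈ A ∧ t ≤ g e := by simpa using he
    refine M.closure_subset_closure ?_ (h e he.1 (by omega))
    rintro f ⟨hf, hef⟩
    simp only [Finset.coe_filter, Set.mem_ofPred_eq]
    exact ⟨hf, he.2.trans hef⟩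
  have h2 : M.Indep ((A.filter fun e => t ≤ g e : Finset V) : Set V) :=
    hA.subset (Finset.coe_subset.2 (Finset.filter_subset _ A))
  have h3 := (h2.encard_le_eRk_of_subset h1).trans
    ((M.eRk_closure_eq _).le.trans (M.eRk_le_encard _))
  simpa only [Set.encard_coe_eq_coe_finsetCard, Nat.cast_le] using h3

/-! ### Unfolding -/

/-- The matroid on `U` obtained by placing each `u : U` as a copy of `π u` into the layer `ℓ u`
of a direct sum of copies of `M`; elements without a layer are loops. -/
noncomputable def Matroid.unfold {U V ι : Type} (M : Matroid V) (π : U → V) (ℓ : U → Option ι) :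
    Matroid U :=
  (Matroid.sigma fun j : Option ι => j.elim (Matroid.loopyOn Set.univ) fun _ => M).comap
    fun u => (⟨ℓ u, π u⟩ : (_ : Option ι) × V)

/-- No two elements are copies of the same element in the same layer. -/
def IsLayering {U V ι : Type} (π : U → V) (ℓ : U → Option ι) : Prop :=
  ∀ u u', ℓ u ≠ none → ℓ u = ℓ u' → π u = π u' → u = u'

/-- The elements of `V` with a copy from `S` in the layer `j`. -/
def layer {U V ι : Type} [DecidableEq V] [DecidableEq ι] (π : U → V) (ℓ : U → Option ι)
    (S : Finset U) (j : ι) : Finset V :=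
  (S.filter fun u => ℓ u = some j).image π

lemma Matroid.unfold_ground {U V ι : Type} (M : Matroid V) {π : U → V} {ℓ : U → Option ι}
    (hE : M.E = Set.univ) : (M.unfold π ℓ).E = Set.univ := by
  ext u
  cases h : ℓ u <;> simp [Matroid.unfold, h, hE]

section Unfold

variable {U V ι : Type} [DecidableEq V] [DecidableEq ι] (M : Matroid V) {π : U → V}
  {ℓ : U → Option ι}

lemma mem_layer {S : Finset U} {j : ι} {e : V} :
    e ∈ layer π ℓ S j ↔ ∃ u ∈ S, ℓ u = some j ∧ π u = e := by
  simp [layer, and_assoc]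

/-- Independence in a comap demands injectivity on the set besides independence of the image; the
layering hypothesis supplies the injectivity. -/
lemma Matroid.unfold_indep_iff (hπ : IsLayering π ℓ) (S : Finset U) :
    (M.unfold π ℓ).Indep (S : Set U) ↔
      (∀ u ∈ S, ℓ u ≠ none) ∧ ∀ j, M.Indep (layer π ℓ S j : Set V) := by
  have h1 : ∀ j, (Sigma.mk j ⁻¹' ((fun u => (⟨ℓ u, π u⟩ : (_ : Option ι) × V)) '' (S : Set U))) =
      {e | ∃ u ∈ S, ℓ u = j ∧ π u = e} := by
    intro j
    ext e
    simp only [Set.mem_preimage, Set.mem_image, Finset.mem_coe, Sigma.mk.injEq, heq_eq_eq]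
    rfl
  have h2 : ∀ j, ((layer π ℓ S j : Finset V) : Set V) = {e | ∃ u ∈ S, ℓ u = some j ∧ π u = e} := by
    intro j
    ext e
    exact mem_layer
  simp only [Matroid.unfold, Matroid.comap_indep_iff, Matroid.sigma_indep_iff, h1, h2]
  constructor
  · rintro ⟨h, -⟩
    refine ⟨fun u hu hn => ?_, fun j => h (some j)⟩
    have := h none
    simp only [Option.elim_none, Matroid.loopyOn_indep_iff] at this
    exact (Set.ext_iff.1 this (π u)).1 ⟨u, hu, hn, rfl⟩
  · rintro ⟨h, h'⟩
    refine ⟨fun j => ?_, ?_⟩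
    · cases j with
      | none =>
        simp only [Option.elim_none, Matroid.loopyOn_indep_iff]
        ext e
        simp only [Set.mem_ofPred_eq, Set.mem_empty_iff_false, iff_false]
        rintro ⟨u, hu, hn, -⟩
        exact h u hu hn
      | some j => exact h' j
    · intro u hu u' hu' huu'
      simp only [Sigma.mk.injEq, heq_eq_eq] at huu'
      exact hπ u u' (h u hu) huu'.1 huu'.2

/-- Bases of the layers together form a basis of the image in the direct sum, where the layer `none`
contributes nothing. Parallel copies do not affect rank, so no layering hypothesis is needed. -/
lemma Matroid.unfold_eRk [Fintype ι] (hE : M.E = Set.univ) (S : Finset U) :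
    (M.unfold π ℓ).eRk (S : Set U) = ∑ j, M.eRk (layer π ℓ S j : Set V) := by
  classical
  rw [Matroid.unfold, Matroid.eRk_comap]
  choose I hI using fun j => M.exists_isBasis (layer π ℓ S j : Set V) (by simp [hE])
  have hfin : ∀ j, (I j).Finite := fun j => (layer π ℓ S j).finite_toSet.subset (hI j).subset
  set J : Option ι → Finset V := fun j => j.elim ∅ fun j => (hfin j).toFinset with hJ
  have hcoe : ∀ j, (Sigma.mk j ⁻¹' ((Finset.univ.sigma J : Finset ((_ : Option ι) × V)) :
      Set ((_ : Option ι) × V))) = J j := by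
    intro j
    ext e
    simp
  have h1 : ∀ j, (Sigma.mk (some j) ⁻¹'
      ((fun u => (⟨ℓ u, π u⟩ : (_ : Option ι) × V)) '' (S : Set U))) = layer π ℓ S j := by
    intro j
    ext e
    simp only [Set.mem_preimage, Set.mem_image, Finset.mem_coe, Sigma.mk.injEq, heq_eq_eq,
      mem_layer]
  have hbas : (Matroid.sigma fun j : Option ι =>
      j.elim (Matroid.loopyOn Set.univ) fun _ => M).IsBasis
      ((Finset.univ.sigma J : Finset ((_ : Option ι) × V)) : Set ((_ : Option ι) × V))
      ((fun u => (⟨ℓ u, π u⟩ : (_ : Option ι) × V)) '' (S : Set U)) := by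
    rw [Matroid.sigma_isBasis_iff]
    intro j
    rw [hcoe]
    cases j with
    | none => simp [hJ]
    | some j =>
      rw [h1]
      simpa [hJ] using hI j
  rw [hbas.eRk_eq_encard, Set.encard_coe_eq_coe_finsetCard, Finset.card_sigma,
    Fintype.sum_option]
  simp only [hJ, Option.elim_none, Option.elim_some, Finset.card_empty, zero_add, Nat.cast_sum]
  refine Finset.sum_congr rfl fun j _ => ?_
  rw [(hI j).eRk_eq_encard, (hfin j).encard_eq_coe_toFinset_card]

end Unfold

/-- The oracle answer for a set in an unfolded matroid from the answers for its layers. -/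
def OracleKind.combine : (o : OracleKind) → Bool → List o.Answer → o.Answer
  | .independence, b, as => b && List.all as (fun a => (a : Bool))
  | .rank, _, as => (List.sum (as : List ℕ) : ℕ)

lemma OracleKind.combine_answer {U V : Type} [DecidableEq V] {L : ℕ} (o : OracleKind)
    (M : Matroid V) (hE : M.E = Set.univ) {π : U → V} {ℓ : U → Option (Fin L)}
    (hπ : IsLayering π ℓ) (S : Finset U) :
    o.combine (decide (∀ u ∈ S, ℓ u ≠ none))
      ((List.finRange L).map fun j => o.answer M (layer π ℓ S j)) =
      o.answer (M.unfold π ℓ) S := by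
  classical
  cases o with
  | independence =>
    change (_ && List.all ((List.finRange L).map fun j =>
      decide (M.Indep (layer π ℓ S j : Set V))) (fun a => a) : Bool) =
        decide ((M.unfold π ℓ).Indep (S : Set U))
    rw [Bool.eq_iff_iff, decide_eq_true_iff, M.unfold_indep_iff hπ, Bool.and_eq_true,
      decide_eq_true_iff, List.all_map, List.all_eq_true]
    refine and_congr_right fun _ => ⟨fun h j => ?_, fun h j _ => ?_⟩
    · exact of_decide_eq_true (h j (List.mem_finRange j))
    · exact decide_eq_true (h j)
  | rank =>
    change (List.sum ((List.finRange L).map fun j => (M.eRk (layer π ℓ S j : Set V)).toNat) : ℕ) =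
      ((M.unfold π ℓ).eRk (S : Set U)).toNat
    have h : ∀ j, M.eRk (layer π ℓ S j : Set V) ≠ ⊤ := fun j =>
      ((M.eRk_le_encard _).trans_lt (by simp [Set.encard_coe_eq_coe_finsetCard])).ne
    rw [M.unfold_eRk hE, ENat.toNat_sum fun j _ => h j, ← List.ofFn_eq_map, List.sum_ofFn]

namespace QueryProgram

variable {U V : Type} {o : OracleKind} {β : Type} [DecidableEq V] {L : ℕ}

/-- Answer a query to an unfolded matroid by one query for each layer. -/
def layeredQuery (π : U → V) (ℓ : U → Option (Fin L)) (i : Fin 2) (S : Finset U) :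
    QueryProgram V o o.Answer :=
  (mapList (fun j => query i (layer π ℓ S j) fun a => ret a) (List.finRange L)).bind fun as =>
    ret (o.combine (decide (∀ u ∈ S, ℓ u ≠ none)) as)

/-- Run a program for the unfolded matroids. -/
def simulate (π : U → V) (ℓ : Fin 2 → U → Option (Fin L)) :
    QueryProgram U o β → QueryProgram V o β
  | .ret b => .ret b
  | .query i S next => (layeredQuery π (ℓ i) i S).bind fun a => simulate π ℓ (next a)

lemma run_layeredQuery (M : Fin 2 → Matroid V) (hM : IsInstance M) {π : U → V}
    {ℓ : U → Option (Fin L)} (hπ : IsLayering π ℓ) (i : Fin 2) (S : Finset U) :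
    (layeredQuery π ℓ i S : QueryProgram V o _).run M = o.answer ((M i).unfold π ℓ) S := by
  simp [layeredQuery, ← o.combine_answer (M i) (hM i) hπ]

lemma cost_layeredQuery (M : Fin 2 → Matroid V) (π : U → V)
    (ℓ : U → Option (Fin L)) (i : Fin 2) (S : Finset U) :
    (layeredQuery π ℓ i S : QueryProgram V o _).cost M = L := by
  simp [layeredQuery, cost_mapList]

lemma run_simulate (M : Fin 2 → Matroid V) (hM : IsInstance M) {π : U → V}
    {ℓ : Fin 2 → U → Option (Fin L)} (hπ : ∀ i, IsLayering π (ℓ i)) (P : QueryProgram U o β) :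
    (P.simulate π ℓ).run M = P.run fun i => (M i).unfold π (ℓ i) := by
  induction P with
  | ret b => rfl
  | query i S next ih => simp [simulate, run_layeredQuery M hM (hπ i), ih]

lemma cost_simulate (M : Fin 2 → Matroid V) (hM : IsInstance M) {π : U → V}
    {ℓ : Fin 2 → U → Option (Fin L)} (hπ : ∀ i, IsLayering π (ℓ i)) (P : QueryProgram U o β) :
    (P.simulate π ℓ).cost M = L * P.cost fun i => (M i).unfold π (ℓ i) := by
  induction P with
  | ret b => rfl
  | query i S next ih =>
    simp [simulate, run_layeredQuery M hM (hπ i), cost_layeredQuery, ih]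
    ring

end QueryProgram

/-! ### Copies of weighted elements -/

/-- The layer of the `k`-th copy of an element of weight `w`: in the first matroid the copies are
placed in increasing order, in the second one in decreasing order. -/
def copyLayerIndex (i : Fin 2) (w k : ℕ) : ℕ :=
  if i = 0 then k else w - 1 - k

/-- The layers of the copies of elements with integer weights. -/
def copyLayer {U V : Type} {L : ℕ} (π : U → V) (idx : U → Fin L) (w : V → ℕ) (i : Fin 2)
    (u : U) : Option (Fin L) :=
  if h : (idx u : ℕ) < w (π u) ∧ copyLayerIndex i (w (π u)) (idx u) < L then
    some ⟨copyLayerIndex i (w (π u)) (idx u), h.2⟩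
  else none

/-- The pair of matroids in which each element has been replaced by as many copies as its
weight. -/
noncomputable def unfoldPair {U V : Type} {L : ℕ} (M : Fin 2 → Matroid V) (π : U → V)
    (idx : U → Fin L) (w : V → ℕ) : Fin 2 → Matroid U :=
  fun i => (M i).unfold π (copyLayer π idx w i)

section Copies

variable {U V : Type} {L : ℕ} {π : U → V} {idx : U → Fin L} {w : V → ℕ}

lemma copyLayer_eq_some {i : Fin 2} {u : U} {j : Fin L} :
    copyLayer π idx w i u = some j ↔
      (idx u : ℕ) < w (π u) ∧ copyLayerIndex i (w (π u)) (idx u) = j := by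
  unfold copyLayer
  split_ifs with h
  · simp [Fin.ext_iff, h.1]
  · simp only [false_iff]
    rintro ⟨h1, h2⟩
    exact h ⟨h1, h2 ▸ j.2⟩

/-- For a fixed element, both the increasing and the decreasing numbering of its copies are
injective; truncation in `w - 1 - k` is harmless because a copy with a layer has `k < w`. -/
lemma isLayering_copyLayer (hinj : ∀ u u', π u = π u' → idx u = idx u' → u = u') (i : Fin 2) :
    IsLayering π (copyLayer π idx w i) := by
  intro u u' hu huu' hπ
  obtain ⟨j, hj⟩ := Option.ne_none_iff_exists'.1 hu
  have hj' := huu' ▸ hj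
  rw [copyLayer_eq_some] at hj hj'
  rw [← hπ] at hj'
  refine hinj u u' hπ (Fin.ext ?_)
  have h := hj.2.trans hj'.2.symm
  unfold copyLayerIndex at h
  split_ifs at h <;> omega

lemma isInstance_unfoldPair {M : Fin 2 → Matroid V} (hM : IsInstance M) :
    IsInstance (unfoldPair M π idx w) :=
  fun i => (M i).unfold_ground (hM i)

lemma IsLayering.sum_eq [DecidableEq V] {ℓ : U → Option (Fin L)} (hℓ : IsLayering π ℓ)
    (T : Finset U) (hT : ∀ u ∈ T, ℓ u ≠ none) (F : U → ℕ) (f : Fin L → V → ℕ)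
    (hF : ∀ u ∈ T, ∀ j, ℓ u = some j → F u = f j (π u)) :
    ∑ u ∈ T, F u = ∑ j, ∑ e ∈ layer π ℓ T j, f j e := by
  have h1 : ∀ j, ∑ e ∈ layer π ℓ T j, f j e = ∑ u ∈ T with ℓ u = some j, F u := by
    intro j
    rw [layer, Finset.sum_image]
    · refine Finset.sum_congr rfl fun u hu => ?_
      rw [Finset.mem_filter] at hu
      exact (hF u hu.1 j hu.2).symm
    · intro u hu u' hu' h
      simp only [Finset.coe_filter, Set.mem_ofPred_eq] at hu hu'
      exact hℓ u u' (by simp [hu.2]) (hu.2.trans hu'.2.symm) h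
  simp_rw [h1, Finset.sum_filter]
  rw [Finset.sum_comm]
  refine Finset.sum_congr rfl fun u hu => ?_
  obtain ⟨j, hj⟩ := Option.ne_none_iff_exists'.1 (hT u hu)
  simp [hj]

/-- Cutting `x` into consecutive blocks of length `q`, the `j`-th summand is the part of `x` in
block `j`. -/
lemma sum_range_min_sub (q x L : ℕ) :
    ∑ j ∈ Finset.range L, min q (x - q * j) = min (q * L) x := by
  induction L with
  | zero => simp
  | succ L ih =>
    rw [Finset.sum_range_succ, ih, Nat.mul_succ]
    generalize q * L = a
    omega

/-- An independent set of copies is dominated by a set `B` that dominates its elements. -/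
lemma sum_copies_le [DecidableEq V] (M : Matroid V)
    (hinj : ∀ u u', π u = π u' → idx u = idx u' → u = u') (i : Fin 2) (T : Finset U)
    (hT : (M.unfold π (copyLayer π idx w i)).Indep (T : Set U)) (q : ℕ) (x x' : V → ℕ)
    (B : Finset V)
    (hB : ∀ e ∈ T.image π, 0 < x e → e ∈ M.closure {f | f ∈ B ∧ x e ≤ x' f}) :
    ∑ u ∈ T, min q (x (π u) - q * copyLayerIndex i (w (π u)) (idx u)) ≤ ∑ f ∈ B, x' f := by
  have hℓ := isLayering_copyLayer (w := w) hinj i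
  rw [M.unfold_indep_iff hℓ] at hT
  rw [hℓ.sum_eq T hT.1 _ (fun j e => min q (x e - q * j))
    (fun u _ j hj => by rw [(copyLayer_eq_some.1 hj).2])]
  -- Within one layer the summand is a monotone function of `x`, so domination for `x` carries over
  -- to it.
  calc _ ≤ ∑ j : Fin L, ∑ f ∈ B, min q (x' f - q * j) := by
        refine Finset.sum_le_sum fun j _ => ?_
        refine M.sum_le_sum_of_dominated _ _ _ _ (hT.2 j) fun e he hpos => ?_
        obtain ⟨u, hu, -, rfl⟩ := mem_layer.1 he
        refine M.closure_subset_closure ?_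
          (hB (π u) (Finset.mem_image_of_mem _ hu) (by omega))
        rintro f ⟨hf, hef⟩
        exact ⟨hf, by omega⟩
    _ = ∑ f ∈ B, ∑ j ∈ Finset.range L, min q (x' f - q * j) := by
        rw [Finset.sum_comm]
        refine Finset.sum_congr rfl fun f _ => ?_
        rw [Finset.sum_range]
    _ ≤ ∑ f ∈ B, x' f := by
        refine Finset.sum_le_sum fun f _ => ?_
        rw [sum_range_min_sub]
        exact min_le_right _ _

/-- The blocks before copy `k` in the two orders have total length `q * (w - 1)`, which leaves at
least `q - 1` of `x + y` for the copy itself. This is why the two matroids number the copies in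
opposite directions. -/
lemma le_min_sub_add_min_sub {q w k x y : ℕ} (hk : k < w) (h : q * w ≤ x + y + 1) :
    q - 1 ≤ min q (x - q * k) + min q (y - q * (w - 1 - k)) := by
  obtain ⟨d, rfl⟩ := Nat.exists_eq_add_of_lt hk
  have h1 : k + d + 1 - 1 - k = d := by omega
  have h2 : q * (k + d + 1) = q * k + q * d + q := by ring
  rw [h1]
  rw [h2] at h
  generalize q * k = a at *
  generalize q * d = b at *
  omega

/-- The number of copies in a common independent set is bounded by the value of a pair of sets
that dominate its elements for complementary prices. -/
lemma card_copies_le [DecidableEq V] (M : Fin 2 → Matroid V)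
    (hinj : ∀ u u', π u = π u' → idx u = idx u' → u = u') (T : Finset U)
    (hT : IsCommonIndep (unfoldPair M π idx w) T) (q : ℕ) (x y x' y' : V → ℕ)
    (B S : Finset V) (hxy : ∀ e ∈ T.image π, q * w e ≤ x e + y e + 1)
    (hB : ∀ e ∈ T.image π, 0 < x e → e ∈ (M 0).closure {f | f ∈ B ∧ x e ≤ x' f})
    (hS : ∀ e ∈ T.image π, 0 < y e → e ∈ (M 1).closure {f | f ∈ S ∧ y e ≤ y' f}) :
    (q - 1) * T.card ≤ ∑ f ∈ B, x' f + ∑ f ∈ S, y' f := by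
  have hT0 := ((M 0).unfold_indep_iff (isLayering_copyLayer (w := w) hinj 0) T).1 (hT 0)
  refine le_trans ?_ (Nat.add_le_add (sum_copies_le (M 0) hinj 0 T (hT 0) q x x' B hB)
    (sum_copies_le (M 1) hinj 1 T (hT 1) q y y' S hS))
  rw [← Finset.sum_add_distrib, mul_comm, ← smul_eq_mul, ← Finset.sum_const]
  refine Finset.sum_le_sum fun u hu => ?_
  obtain ⟨j, hj⟩ := Option.ne_none_iff_exists'.1 (hT0.1 u hu)
  exact le_min_sub_add_min_sub (copyLayer_eq_some.1 hj).1
    (hxy _ (Finset.mem_image_of_mem _ hu))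

/-- The copies of a common independent set form a common independent set. -/
lemma exists_copies [Fintype U] (M : Fin 2 → Matroid V)
    (hinj : ∀ u u', π u = π u' → idx u = idx u' → u = u')
    (hsurj : ∀ (e : V) (k : Fin L), ∃ u, π u = e ∧ idx u = k) (hw : ∀ e, w e ≤ L)
    (I : Finset V) (hI : IsCommonIndep M I) :
    ∃ T : Finset U, IsCommonIndep (unfoldPair M π idx w) T ∧ T.card = ∑ e ∈ I, w e := by
  classical
  choose c hc using hsurj
  refine ⟨Finset.univ.filter fun u => π u ∈ I ∧ (idx u : ℕ) < w (π u), fun i => ?_, ?_⟩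
  · refine ((M i).unfold_indep_iff (isLayering_copyLayer (w := w) hinj i) _).2
      ⟨fun u hu => ?_, fun j => (hI i).subset ?_⟩
    · have hu := (Finset.mem_filter.1 hu).2.2
      have h : copyLayerIndex i (w (π u)) (idx u) < L := by
        have := hw (π u)
        unfold copyLayerIndex
        split_ifs <;> omega
      simp [copyLayer, hu, h]
    · intro e he
      obtain ⟨u, hu, -, rfl⟩ := mem_layer.1 he
      exact (Finset.mem_filter.1 hu).2.1
  · rw [Finset.card_eq_sum_card_fiberwise (f := π) (t := I)]
    · refine Finset.sum_congr rfl fun e he => ?_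
      rw [← Finset.card_range (w e)]
      refine Finset.card_bij (fun u _ => (idx u : ℕ)) ?_ ?_ ?_
      · intro u hu
        simp only [Finset.mem_filter, Finset.mem_univ, true_and] at hu
        rw [Finset.mem_range, ← hu.2]
        exact hu.1.2
      · intro u hu u' hu' h
        simp only [Finset.mem_filter, Finset.mem_univ, true_and] at hu hu'
        exact hinj u u' (hu.2.trans hu'.2.symm) (Fin.ext h)
      · intro k hk
        rw [Finset.mem_range] at hk
        have := hc e ⟨k, hk.trans_le (hw e)⟩
        refine ⟨c e ⟨k, hk.trans_le (hw e)⟩, ?_, ?_⟩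
        · simp [this.1, this.2, he, hk]
        · simp [this.2]
    · intro u hu
      simp only [Finset.coe_filter, Set.mem_ofPred_eq] at hu
      exact hu.2.1

end Copies

/-! ### The matroid auction -/

/-- The elements whose price does not exceed their value. -/
def activeSet {V : Type} (X : Finset V) (v p : V → ℕ) : Finset V :=
  X.filter fun e => p e ≤ v e

/-- The order in which the first matroid selects elements: by decreasing utility, with ties broken
in favour of the current set `S`. -/
def auctionKey {V : Type} [DecidableEq V] (v p : V → ℕ) (S : Finset V) (e : V) : ℕ :=
  2 * (v e - p e) + if e ∈ S then 1 else 0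

/-- The prices after the elements of `B` outside of `S` have been rejected. -/
def raisePrices {V : Type} [DecidableEq V] (p : V → ℕ) (B S : Finset V) (e : V) : ℕ :=
  if e ∈ B \ S then p e + 1 else p e

/-- The invariant of the auction with prices `p` and current set `S`. -/
structure AuctionInvariant {V : Type} (M : Fin 2 → Matroid V) (X : Finset V) (v p : V → ℕ)
    (S : Finset V) : Prop where
  subset_active : S ⊆ activeSet X v p
  price_le : ∀ e ∈ X, p e ≤ v e + 1
  rejected : ∀ e ∈ X, ∀ k < p e, e ∈ (M 1).closure {f | f ∈ S ∧ k ≤ p f}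
  kept : ∀ f ∈ S, f ∉ (M 0).closure
    ({e | e ∈ activeSet X v p ∧ v f - p f < v e - p e} ∪ {g | g ∈ S ∧ g ≠ f})

/-- One round of the auction: `B` is a greedy selection of the first matroid from the active
elements, `S'` one of the second matroid from `B`. -/
structure AuctionRound {V : Type} [DecidableEq V] (M : Fin 2 → Matroid V) (X : Finset V)
    (v p : V → ℕ) (S B S' : Finset V) : Prop where
  offer_subset : B ⊆ activeSet X v p
  offer_indep : (M 0).Indep (B : Set V)
  offer_dominates : ∀ e ∈ activeSet X v p,
    e ∈ (M 0).closure {f | f ∈ B ∧ auctionKey v p S e ≤ auctionKey v p S f}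
  choice_subset : S' ⊆ B
  choice_indep : (M 1).Indep (S' : Set V)
  choice_dominates : ∀ e ∈ B, e ∈ (M 1).closure {f | f ∈ S' ∧ p e ≤ p f}

section Auction

variable {V : Type} {M : Fin 2 → Matroid V} {X : Finset V} {v p : V → ℕ} {S : Finset V}

lemma mem_activeSet {e : V} : e ∈ activeSet X v p ↔ e ∈ X ∧ p e ≤ v e := by
  simp [activeSet]

lemma AuctionInvariant.init (M : Fin 2 → Matroid V) (X : Finset V) (v : V → ℕ) :
    AuctionInvariant M X v (fun _ => 0) ∅ :=
  ⟨by simp, by simp, by simp, by simp⟩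

variable [DecidableEq V] {B S' : Finset V}

/-- Utility is doubled in `auctionKey`, so the tie-breaking bit never reverses an order of
utilities. -/
lemma AuctionRound.offer_dominates_utility (hr : AuctionRound M X v p S B S') {e : V}
    (he : e ∈ activeSet X v p) : e ∈ (M 0).closure {f | f ∈ B ∧ v e - p e ≤ v f - p f} := by
  refine (M 0).closure_subset_closure ?_ (hr.offer_dominates e he)
  rintro f ⟨hf, hef⟩
  refine ⟨hf, ?_⟩
  unfold auctionKey at hef
  split_ifs at hef <;> omega

/-- Elements once chosen are offered again. If `f ∈ S` were left out, it would be spanned by offered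
elements with at least its key; by the tie-breaking these lie in `S` or have strictly larger
utility, against `kept`. -/
lemma AuctionRound.subset_offer (hr : AuctionRound M X v p S B S')
    (hi : AuctionInvariant M X v p S) : S ⊆ B := by
  intro f hf
  by_contra hfB
  refine hi.kept f hf ((M 0).closure_subset_closure ?_
    (hr.offer_dominates f (hi.subset_active hf)))
  rintro g ⟨hg, hfg⟩
  have hne : g ≠ f := fun h => hfB (h ▸ hg)
  by_cases hgS : g ∈ S
  · exact Or.inr ⟨hgS, hne⟩
  · refine Or.inl ⟨hr.offer_subset hg, ?_⟩
    simp only [auctionKey, hf, hgS, if_true, if_false] at hfg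
    omega

/-- Old rejections stay justified: the old set `S` is contained in `B`, and the new choice spans `B`
without using lower prices. -/
lemma AuctionRound.choice_dominates_rejected (hr : AuctionRound M X v p S B S')
    (hi : AuctionInvariant M X v p S) {e : V} (he : e ∈ X) {k : ℕ} (hk : k < p e) :
    e ∈ (M 1).closure {f | f ∈ S' ∧ k ≤ p f} := by
  refine (M 1).closure_subset_closure_of_subset_closure ?_ (hi.rejected e he k hk)
  rintro f ⟨hf, hkf⟩
  refine (M 1).closure_subset_closure ?_ (hr.choice_dominates f (hr.subset_offer hi hf))
  rintro g ⟨hg, hfg⟩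
  exact ⟨hg, hkf.trans hfg⟩

lemma raisePrices_of_mem {f : V} (hf : f ∈ S') : raisePrices p B S' f = p f := by
  simp [raisePrices, hf]

lemma le_raisePrices (e : V) : p e ≤ raisePrices p B S' e := by
  unfold raisePrices
  split_ifs <;> omega

lemma AuctionRound.invariant (hr : AuctionRound M X v p S B S') (hM : IsInstance M)
    (hi : AuctionInvariant M X v p S) : AuctionInvariant M X v (raisePrices p B S') S' := by
  refine ⟨fun f hf => ?_, fun e he => ?_, fun e he k hk => ?_, fun f hf => ?_⟩
  · rw [mem_activeSet, raisePrices_of_mem hf, ← mem_activeSet]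
    exact hr.offer_subset (hr.choice_subset hf)
  · unfold raisePrices
    split_ifs with h
    · have := (mem_activeSet.1 (hr.offer_subset (Finset.mem_sdiff.1 h).1)).2
      omega
    · exact hi.price_le e he
  · have hsub : ∀ m, {f | f ∈ S' ∧ m ≤ p f} ⊆ {f | f ∈ S' ∧ m ≤ raisePrices p B S' f} :=
      fun m f hf => ⟨hf.1, hf.2.trans (le_raisePrices f)⟩
    refine (M 1).closure_subset_closure (hsub k) ?_
    by_cases hkp : k < p e
    · exact hr.choice_dominates_rejected hi he hkp
    · unfold raisePrices at hk
      split_ifs at hk with h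
      · have : k = p e := by omega
        exact this ▸ hr.choice_dominates e (Finset.mem_sdiff.1 h).1
      · omega
  -- Prices only rise, so an element that now beats `f` beat it before and is spanned by offered
  -- elements other than `f`. Together with the rest of `S'` these lie in `B` without `f`, which
  -- cannot span `f`.
  · have hfB := hr.choice_subset hf
    intro hcl
    refine hr.offer_indep.notMem_closure_sdiff_of_mem hfB
      ((M 0).closure_subset_closure_of_subset_closure ?_ hcl)
    rintro e (⟨he, hfe⟩ | ⟨he, hfe⟩)
    · rw [raisePrices_of_mem hf] at hfe
      rw [mem_activeSet] at he
      have hpe := le_raisePrices (p := p) (B := B) (S' := S') e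
      refine (M 0).closure_subset_closure ?_
        (hr.offer_dominates_utility (mem_activeSet.2 ⟨he.1, hpe.trans he.2⟩))
      rintro g ⟨hg, heg⟩
      refine ⟨hg, ?_⟩
      rintro rfl
      omega
    · exact (M 0).mem_closure_of_mem' ⟨hr.choice_subset he, hfe⟩ (by simp [hM 0])

/-- The total price is the potential that counts rejections. -/
lemma AuctionRound.sum_raisePrices (hr : AuctionRound M X v p S B S') :
    ∑ e ∈ X, raisePrices p B S' e = ∑ e ∈ X, p e + (B \ S').card := by
  have h : ∀ e, raisePrices p B S' e = p e + if e ∈ B \ S' then 1 else 0 := by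
    intro e
    unfold raisePrices
    split_ifs <;> rfl
  have h2 : X ∩ (B \ S') = B \ S' := Finset.inter_eq_right.2 fun e he =>
    (mem_activeSet.1 (hr.offer_subset (Finset.mem_sdiff.1 he).1)).1
  simp_rw [h]
  rw [Finset.sum_add_distrib, Finset.sum_ite_mem, h2]
  simp

/-- The value of the set chosen in a round is close to the number of copies in a common
independent set if few elements are rejected. -/
lemma AuctionRound.card_copies_le {U : Type} {L : ℕ} {π : U → V} {idx : U → Fin L} {w : V → ℕ}
    (hinj : ∀ u u', π u = π u' → idx u = idx u' → u = u') (q : ℕ)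
    (hr : AuctionRound M X (fun e => q * w e) p S B S')
    (hi : AuctionInvariant M X (fun e => q * w e) p S) (T : Finset U)
    (hT : IsCommonIndep (unfoldPair M π idx w) T) (hX : T.image π ⊆ X) (hw : ∀ e, w e ≤ L) :
    (q - 1) * T.card ≤ ∑ f ∈ S', q * w f + (B \ S').card * (q * L) := by
  -- The dual splitting is utility against price minus one. A price `p e` only certifies a rejection
  -- at `p e - 1`, which is what the slack of one in `card_copies_le` pays for.
  refine (_root_.card_copies_le M hinj T hT q (fun e => q * w e - p e) (fun e => p e - 1)
    (fun e => q * w e - p e) p B S' (fun e _ => by omega)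
    (fun e he hpos => hr.offer_dominates_utility (mem_activeSet.2 ⟨hX he, by omega⟩))
    (fun e he hpos => hr.choice_dominates_rejected hi (hX he) (by omega))).trans ?_
  rw [← Finset.sum_sdiff hr.choice_subset]
  have h1 : ∑ f ∈ S', (q * w f - p f) + ∑ f ∈ S', p f = ∑ f ∈ S', q * w f := by
    rw [← Finset.sum_add_distrib]
    refine Finset.sum_congr rfl fun f hf => ?_
    have := (mem_activeSet.1 (hr.offer_subset (hr.choice_subset hf))).2
    omega
  -- On `S'` utility and price add up to the value; only rejected elements leave an excess.
  have h2 : ∑ f ∈ B \ S', (q * w f - p f) ≤ (B \ S').card * (q * L) := by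
    rw [← smul_eq_mul, ← Finset.sum_const]
    exact Finset.sum_le_sum fun f _ => (Nat.sub_le _ _).trans (Nat.mul_le_mul_left _ (hw f))
  omega

end Auction

/-! ### The best round of the auction -/

/-- An element of `d :: l` with the largest value of `f`. -/
noncomputable def bestBy {β R : Type} [LinearOrder R] (f : β → R) (d : β) : List β → β
  | [] => d
  | b :: l => if f (bestBy f d l) ≤ f b then b else bestBy f d l

lemma bestBy_mem {β R : Type} [LinearOrder R] (f : β → R) (d : β) (l : List β) :
    bestBy f d l = d ∨ bestBy f d l ∈ l := by
  induction l with
  | nil => exact Or.inl rfl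
  | cons b l ih =>
    unfold bestBy
    split_ifs
    · simp
    · rcases ih with h | h
      · exact Or.inl h
      · exact Or.inr (List.mem_cons_of_mem _ h)

lemma le_bestBy {β R : Type} [LinearOrder R] (f : β → R) (d : β) (l : List β) :
    ∀ b ∈ l, f b ≤ f (bestBy f d l) := by
  induction l with
  | nil => simp
  | cons b l ih =>
    intro b' hb'
    unfold bestBy
    split_ifs with h
    · rcases List.mem_cons.1 hb' with rfl | hb'
      · exact le_rfl
      · exact (ih b' hb').trans h
    · rcases List.mem_cons.1 hb' with rfl | hb'
      · exact (not_le.1 h).le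
      · exact ih b' hb'

namespace QueryProgram

variable {V : Type} {o : OracleKind} [DecidableEq V]

/-- The sets chosen in `m` rounds of the auction. -/
noncomputable def auctionRounds (X : Finset V) (v : V → ℕ) :
    ℕ → (V → ℕ) → Finset V → QueryProgram V o (List (Finset V))
  | 0, _, _ => .ret []
  | m + 1, p, S =>
    (greedyBasis 0 (auctionKey v p S) (activeSet X v p)).bind fun B =>
      (greedyBasis 1 p B).bind fun S' =>
        (auctionRounds X v m (raisePrices p B S') S').bind fun l => .ret (S' :: l)

lemma auctionRound_greedyBasis (M : Fin 2 → Matroid V) (hM : IsInstance M) (X : Finset V)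
    (v p : V → ℕ) (S : Finset V) :
    let B := (greedyBasis 0 (auctionKey v p S) (activeSet X v p) : QueryProgram V o _).run M
    AuctionRound M X v p S B ((greedyBasis 1 p B : QueryProgram V o _).run M) :=
  ⟨greedyBasis_subset M _ _ _, greedyBasis_indep M _ _ _,
    fun _ he => mem_closure_greedyBasis M 0 (hM 0) _ _ he, greedyBasis_subset M _ _ _,
    greedyBasis_indep M _ _ _, fun _ he => mem_closure_greedyBasis M 1 (hM 1) _ _ he⟩

lemma cost_auctionRounds_le (M : Fin 2 → Matroid V) (X : Finset V) (v : V → ℕ) (m : ℕ)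
    (p : V → ℕ) (S : Finset V) :
    (auctionRounds X v m p S : QueryProgram V o _).cost M ≤ m * (2 * X.card) := by
  induction m generalizing p S with
  | zero => simp [auctionRounds]
  | succ m ih =>
    simp only [auctionRounds, cost_bind, cost_ret, cost_greedyBasis, Nat.add_zero]
    have h1 : (activeSet X v p).card ≤ X.card := Finset.card_filter_le _ _
    have h2 := Finset.card_le_card (greedyBasis_subset (o := o) M 0 (auctionKey v p S)
      (activeSet X v p))
    refine (Nat.add_le_add le_rfl (Nat.add_le_add le_rfl (ih _ _))).trans ?_
    rw [Nat.add_mul]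
    omega

/-- Amortization: a round falls short of `Z` by at most `K` per rejection, and each rejection raises
the total price by one, while prices never exceed `v e + 1`. -/
lemma run_auctionRounds (M : Fin 2 → Matroid V) (hM : IsInstance M) (X : Finset V) (v : V → ℕ)
    (Z K : ℕ)
    (hZ : ∀ (p : V → ℕ) (S B S' : Finset V), AuctionInvariant M X v p S →
      AuctionRound M X v p S B S' → Z ≤ ∑ f ∈ S', v f + (B \ S').card * K)
    (m : ℕ) (p : V → ℕ) (S : Finset V) (hi : AuctionInvariant M X v p S) :
    (∀ S' ∈ (auctionRounds X v m p S : QueryProgram V o _).run M,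
      IsCommonIndep M S' ∧ S' ⊆ X) ∧
    ((auctionRounds X v m p S : QueryProgram V o _).run M).length = m ∧
    m * Z + K * ∑ e ∈ X, p e ≤
      (((auctionRounds X v m p S : QueryProgram V o _).run M).map fun S' => ∑ f ∈ S', v f).sum +
        K * ∑ e ∈ X, (v e + 1) := by
  induction m generalizing p S with
  | zero =>
    refine ⟨by simp [auctionRounds], by simp [auctionRounds], ?_⟩
    simp only [auctionRounds, run_ret, List.map_nil, List.sum_nil, zero_mul, zero_add]
    exact Nat.mul_le_mul_left _ (Finset.sum_le_sum hi.price_le)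
  | succ m ih =>
    simp only [auctionRounds, run_bind, run_ret]
    set B := (greedyBasis 0 (auctionKey v p S) (activeSet X v p) : QueryProgram V o _).run M
    set S' := (greedyBasis 1 p B : QueryProgram V o _).run M
    have hr : AuctionRound M X v p S B S' := auctionRound_greedyBasis M hM X v p S
    obtain ⟨h1, h2, h3⟩ := ih _ _ (hr.invariant hM hi)
    refine ⟨?_, by simp [h2], ?_⟩
    · intro T hT
      rcases List.mem_cons.1 hT with rfl | hT
      · refine ⟨Fin.forall_fin_two.2 ⟨hr.offer_indep.subset (by exact_mod_cast hr.choice_subset),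
          hr.choice_indep⟩, ?_⟩
        exact (hr.choice_subset.trans hr.offer_subset).trans (Finset.filter_subset _ _)
      · exact h1 T hT
    · rw [hr.sum_raisePrices, Nat.mul_add] at h3
      have h4 := hZ p S B S' hi hr
      rw [List.map_cons, List.sum_cons, Nat.add_mul, one_mul]
      rw [mul_comm K (B \ S').card] at h3
      omega

/-- The number of rounds of the auction for a resolution `q` and weights up to `L`. -/
def auctionLength (q L : ℕ) : ℕ := q * L * (q * L + 1)

/-- Turn a common independent set of copies with elements `X` into a common independent set of
almost the same weight. -/
noncomputable def refold (q L : ℕ) (w : V → ℕ) (X : Finset V) : QueryProgram V o (Finset V) :=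
  (auctionRounds X (fun e => q * w e) (auctionLength q L) (fun _ => 0) ∅).bind fun l =>
    .ret (bestBy (fun S => ∑ e ∈ S, q * w e) ∅ l)

lemma cost_refold_le (M : Fin 2 → Matroid V) (q L : ℕ) (w : V → ℕ) (X : Finset V) :
    (refold q L w X : QueryProgram V o _).cost M ≤ auctionLength q L * (2 * X.card) := by
  simpa [refold] using cost_auctionRounds_le M X _ _ _ _

/-- The best round is at least as good as the average one, and `auctionLength` is chosen so that the
total loss through rejections, spread over all rounds, is at most `T.card` per round. -/
lemma refold_spec (M : Fin 2 → Matroid V) (hM : IsInstance M) {U : Type} {q L : ℕ} (hq : 0 < q)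
    (hL : 0 < L) {π : U → V} {idx : U → Fin L} {w : V → ℕ}
    (hinj : ∀ u u', π u = π u' → idx u = idx u' → u = u') (hw : ∀ e, w e ≤ L) (T : Finset U)
    (hT : IsCommonIndep (unfoldPair M π idx w) T) :
    let S := (refold q L w (T.image π) : QueryProgram V o _).run M
    IsCommonIndep M S ∧ S ⊆ T.image π ∧ (q - 1) * T.card ≤ q * ∑ e ∈ S, w e + T.card := by
  intro S
  obtain ⟨h1, h2, h3⟩ := run_auctionRounds (o := o) M hM (T.image π) (fun e => q * w e)
    ((q - 1) * T.card) (q * L)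
    (fun p S B S' hi hr => hr.card_copies_le hinj q hi T hT subset_rfl hw)
    (auctionLength q L) (fun _ => 0) ∅ (AuctionInvariant.init _ _ _)
  have hS : S = bestBy (fun S => ∑ e ∈ S, q * w e) ∅
      ((auctionRounds (T.image π) (fun e => q * w e) (auctionLength q L) (fun _ => 0) ∅ :
        QueryProgram V o _).run M) := by
    simp [S, refold]
  set l := (auctionRounds (T.image π) (fun e => q * w e) (auctionLength q L) (fun _ => 0) ∅ :
        QueryProgram V o _).run M
  have h4 : IsCommonIndep M S ∧ S ⊆ T.image π := by
    rw [hS]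
    rcases bestBy_mem (fun S => ∑ e ∈ S, q * w e) ∅ l with h | h
    · rw [h]
      exact ⟨fun i => by simp, by simp⟩
    · exact h1 _ h
  refine ⟨h4.1, h4.2, ?_⟩
  have h5 : (l.map fun S' => ∑ f ∈ S', q * w f).sum ≤
      auctionLength q L * ∑ f ∈ S, q * w f := by
    rw [← h2, ← smul_eq_mul, ← List.length_map (as := l) fun S' => ∑ f ∈ S', q * w f]
    refine List.sum_le_card_nsmul _ _ fun x hx => ?_
    obtain ⟨S', hS', rfl⟩ := List.mem_map.1 hx
    rw [hS]
    exact le_bestBy (fun S => ∑ e ∈ S, q * w e) ∅ l S' hS'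
  -- The loss is `q * L` per unit of price, and the total price is at most `q * L + 1` per element
  -- of the image.
  have h6 : q * L * ∑ e ∈ T.image π, (q * w e + 1) ≤ auctionLength q L * T.card := by
    rw [auctionLength, mul_assoc (q * L)]
    refine Nat.mul_le_mul_left _ ?_
    calc _ ≤ ∑ e ∈ T.image π, (q * L + 1) := Finset.sum_le_sum fun e _ =>
          Nat.add_le_add_right (Nat.mul_le_mul_left _ (hw e)) _
      _ = (T.image π).card * (q * L + 1) := by rw [Finset.sum_const, smul_eq_mul]
      _ ≤ (q * L + 1) * T.card := by
        rw [mul_comm]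
        exact Nat.mul_le_mul_left _ Finset.card_image_le
  have h7 : 0 < auctionLength q L := by unfold auctionLength; positivity
  rw [Finset.mul_sum]
  refine Nat.le_of_mul_le_mul_left ?_ h7
  rw [Nat.mul_add]
  omega

end QueryProgram

lemma IsCommonIndep.card_le_commonRank {V : Type} [Fintype V] {M : Fin 2 → Matroid V}
    {S : Finset V} (hS : IsCommonIndep M S) : S.card ≤ commonRank M := by
  classical
  exact Finset.le_sup (f := Finset.card) (Finset.mem_filter.2 ⟨Finset.mem_univ _, hS⟩)

/-- A common independent set of copies has at most `2 * L * r` elements. -/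
lemma card_copies_le_commonRank {U V : Type} [Fintype V] (M : Fin 2 → Matroid V)
    (hM : IsInstance M) {L : ℕ} (hL : 0 < L) {π : U → V} {idx : U → Fin L} {w : V → ℕ}
    (hinj : ∀ u u', π u = π u' → idx u = idx u' → u = u') (hw : ∀ e, w e ≤ L) (T : Finset U)
    (hT : IsCommonIndep (unfoldPair M π idx w) T) : T.card ≤ 2 * L * commonRank M := by
  classical
  -- The auction is used here as an existence proof, with either oracle. For `q = 4` it reads `3 *
  -- |T| ≤ 4 * w(S) + |T|`, so `|T| ≤ 2 * w(S)`.
  obtain ⟨h1, -, h3⟩ := QueryProgram.refold_spec (o := .independence) M hM (q := 4) (by norm_num)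
    hL hinj hw T hT
  have h4 := h1.card_le_commonRank
  set S := (QueryProgram.refold 4 L w (T.image π) : QueryProgram V .independence _).run M
  have h5 : ∑ e ∈ S, w e ≤ S.card * L := by
    rw [← smul_eq_mul, ← Finset.sum_const]
    exact Finset.sum_le_sum fun e _ => hw e
  have h6 : S.card * L ≤ L * commonRank M := by
    rw [mul_comm]
    exact Nat.mul_le_mul_left _ h4
  rw [mul_assoc]
  omega

/-! ### Weight classes -/

lemma IsCommonIndep.subset {V : Type} {M : Fin 2 → Matroid V} {S T : Finset V}
    (hT : IsCommonIndep M T) (h : S ⊆ T) : IsCommonIndep M S :=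
  fun i => (hT i).subset (Finset.coe_subset.2 h)

lemma isCommonIndep_empty {V : Type} (M : Fin 2 → Matroid V) : IsCommonIndep M ∅ :=
  fun i => by simp

namespace QueryProgram

/-! ### Solving one class through its copies -/

section Solve

variable {U V : Type} {o : OracleKind}

/-- Run a query tree and replace its output by the empty set if it is not common independent. -/
def verified (t : QueryTree U o) : QueryProgram U o (Finset U) :=
  (ofTree t).bind fun S => (commonIndepTest S).bind fun b => .ret (if b then S else ∅)

lemma run_verified_indep (M : Fin 2 → Matroid U) (t : QueryTree U o) :
    IsCommonIndep M ((verified t).run M) := by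
  simp only [verified, run_bind, run_ofTree, run_ret]
  split_ifs with h
  · exact (run_commonIndepTest M _).1 h
  · exact isCommonIndep_empty M

lemma run_verified (M : Fin 2 → Matroid U) (t : QueryTree U o) (ht : IsCommonIndep M (t.run M)) :
    (verified t).run M = t.run M := by
  simp [verified, (run_commonIndepTest (o := o) M _).2 ht]

lemma cost_verified (M : Fin 2 → Matroid U) (t : QueryTree U o) :
    (verified t).cost M = t.numQueries M + 2 := by
  simp [verified]

variable [DecidableEq V] {L : ℕ}

/-- Run query trees for the cardinality problem on the copies of elements with integer weights and
turn the best result into a common independent set. -/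
noncomputable def solveByCopies (q : ℕ) (π : U → V) (idx : U → Fin L) (w : V → ℕ)
    (ts : List (QueryTree U o)) : QueryProgram V o (Finset V) :=
  (simulate π (copyLayer π idx w) (mapList verified ts)).bind fun l =>
    refold q L w ((bestBy Finset.card ∅ l).image π)

variable {π : U → V} {idx : U → Fin L} {w : V → ℕ}

/-- Verification makes the output common independent even when every tree fails, so failures cost
weight only. Elements of weight zero have only loops as copies and cannot be selected. -/
lemma solveByCopies_spec [Fintype V] (M : Fin 2 → Matroid V) (hM : IsInstance M) {q : ℕ}
    (hq : 0 < q) (hL : 0 < L) (hinj : ∀ u u', π u = π u' → idx u = idx u' → u = u')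
    (hw : ∀ e, w e ≤ L) (ts : List (QueryTree U o)) (c : ℕ)
    (hc : ∀ t ∈ ts, t.numQueries (unfoldPair M π idx w) ≤ c) :
    let P := solveByCopies q π idx w ts
    IsCommonIndep M (P.run M) ∧ (∀ e ∈ P.run M, 0 < w e) ∧
    (∀ t ∈ ts, IsCommonIndep (unfoldPair M π idx w) (t.run (unfoldPair M π idx w)) →
      (q - 2) * (t.run (unfoldPair M π idx w)).card ≤ q * ∑ e ∈ P.run M, w e) ∧
    P.cost M ≤ L * (ts.length * (c + 2)) + auctionLength q L * (4 * L * commonRank M) := by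
  intro P
  set M' := unfoldPair M π idx w with hM'
  have hlay := fun i => isLayering_copyLayer (w := w) hinj i
  have hrun : (simulate π (copyLayer π idx w) (mapList verified ts)).run M =
      ts.map fun t => (verified t).run M' := by
    rw [run_simulate M hM hlay, run_mapList]
    rfl
  set T := bestBy Finset.card ∅ (ts.map fun t => (verified t).run M') with hTdef
  have hT : IsCommonIndep M' T := by
    rcases bestBy_mem Finset.card ∅ (ts.map fun t => (verified t).run M') with h | h
    · rw [hTdef, h]
      exact isCommonIndep_empty _
    · obtain ⟨t, -, ht⟩ := List.mem_map.1 h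
      rw [hTdef, ← ht]
      exact run_verified_indep M' t
  have hP : P.run M = (refold q L w (T.image π) : QueryProgram V o _).run M := by
    simp only [P, solveByCopies, run_bind, hrun]
    rfl
  obtain ⟨h1, h2, h3⟩ := refold_spec (o := o) M hM hq hL hinj hw T hT
  rw [← hP] at h1 h2 h3
  refine ⟨h1, fun e he => ?_, fun t ht hti => ?_, ?_⟩
  · obtain ⟨u, hu, rfl⟩ := Finset.mem_image.1 (h2 he)
    have h4 := (((M 0).unfold_indep_iff (hlay 0) T).1 (hT 0)).1 u hu
    obtain ⟨j, hj⟩ := Option.ne_none_iff_exists'.1 h4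
    exact (Nat.zero_le _).trans_lt (copyLayer_eq_some.1 hj).1
  · have h4 := le_bestBy Finset.card ∅ (ts.map fun t => (verified t).run M') _
      (List.mem_map_of_mem ht)
    rw [run_verified M' t hti] at h4
    have h5 : (q - 2) * T.card ≤ q * ∑ e ∈ P.run M, w e := by
      have : (q - 2) * T.card + T.card = (q - 2 + 1) * T.card := by ring
      rcases Nat.lt_or_ge q 2 with h | h
      · have : q - 2 = 0 := by omega
        simp [this]
      · have h' : q - 2 + 1 = q - 1 := by omega
        rw [h'] at this
        omega
    exact (Nat.mul_le_mul_left _ h4).trans h5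
  · have h4 : P.cost M = L * ((ts.map fun t => (verified t).cost M').sum) +
        (refold q L w (T.image π) : QueryProgram V o _).cost M := by
      simp only [P, solveByCopies, cost_bind, hrun]
      rw [cost_simulate M hM hlay, cost_mapList]
      rfl
    have h5 : (ts.map fun t => (verified t).cost M').sum ≤ ts.length * (c + 2) := by
      rw [← smul_eq_mul, ← List.length_map (as := ts) fun t => (verified t).cost M']
      refine List.sum_le_card_nsmul _ _ fun x hx => ?_
      obtain ⟨t, ht, rfl⟩ := List.mem_map.1 hx
      rw [cost_verified]
      exact Nat.add_le_add_right (hc t ht) 2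
    have h6 := cost_refold_le (o := o) M q L w (T.image π)
    have h7 : 2 * (T.image π).card ≤ 4 * L * commonRank M := by
      have h8 := card_copies_le_commonRank M hM hL hinj hw T hT
      have h9 := Finset.card_image_le (s := T) (f := π)
      have h10 : 4 * L * commonRank M = 2 * (2 * L * commonRank M) := by ring
      omega
    rw [h4]
    exact Nat.add_le_add (Nat.mul_le_mul_left _ h5) (h6.trans (Nat.mul_le_mul_left _ h7))

end Solve

/-! ### Greedy merging of the solutions of the classes -/

section Merge

variable {V : Type} {o : OracleKind} [DecidableEq V]

lemma exists_test_ne_of_notMem_greedyWith (M : Fin 2 → Matroid V)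
    (test : Finset V → QueryProgram V o Bool) (l : List V) (B : Finset V) {e : V} (he : e ∈ l)
    (he' : e ∉ (greedyWith test l B).run M) :
    ∃ C ⊆ (greedyWith test l B).run M, (test (insert e C)).run M ≠ true := by
  induction l generalizing B with
  | nil => simp at he
  | cons a l ih =>
    simp only [greedyWith, run_bind] at he' ⊢
    rcases List.mem_cons.1 he with rfl | he
    · by_cases h : (test (insert e B)).run M = true
      · refine absurd (subset_run_greedyWith M test l _ ?_) he'
        simp [h]
      · refine ⟨B, ?_, h⟩
        have := subset_run_greedyWith M test l (if (test (insert e B)).run M then insert e B else B)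
        simpa [h] using this
    · exact ih _ he he'

/-- Add elements of `S` to `Y` as long as the set remains common independent. -/
noncomputable def mergeInto (S Y : Finset V) : QueryProgram V o (Finset V) :=
  greedyWith commonIndepTest S.toList Y

lemma cost_mergeInto (M : Fin 2 → Matroid V) (S Y : Finset V) :
    (mergeInto S Y : QueryProgram V o _).cost M = 2 * S.card := by
  rw [mergeInto, cost_greedyWith M _ 2 fun _ => rfl, Finset.length_toList]

/-- Every refused element of `S` is spanned by `Y'` in one of the two matroids, and each matroid can
refuse at most `Y.card` elements. -/
lemma mergeInto_spec (M : Fin 2 → Matroid V) (hM : IsInstance M) (S Y : Finset V)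
    (hS : IsCommonIndep M S) (hY : IsCommonIndep M Y) :
    let Y' := (mergeInto S Y : QueryProgram V o _).run M
    IsCommonIndep M Y' ∧ Y ⊆ Y' ∧ Y' ⊆ Y ∪ S ∧ (S \ Y').card ≤ 2 * Y.card := by
  classical
  intro Y'
  have h1 : IsCommonIndep M Y' := run_greedyWith_invariant M _ _
    (fun S h => (run_commonIndepTest M S).1 h) _ _ hY
  have h2 : Y ⊆ Y' := subset_run_greedyWith M _ _ _
  have h3 : Y' ⊆ Y ∪ S := by
    have := run_greedyWith_subset M (commonIndepTest (o := o)) S.toList Y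
    rwa [Finset.toList_toFinset] at this
  refine ⟨h1, h2, h3, ?_⟩
  -- The spanned refused elements and `Y' \ Y` both lie in `S`, so their union is independent; it
  -- lies in the span of `Y'` and therefore has at most `Y'.card` elements.
  have h4 : ∀ i, ((S \ Y').filter fun e => e ∈ (M i).closure (Y' : Set V)).card ≤ Y.card := by
    intro i
    set R := (S \ Y').filter fun e => e ∈ (M i).closure (Y' : Set V) with hR
    have hRS : ∀ e ∈ R, e ∈ S ∧ e ∉ Y' := fun e he =>
      Finset.mem_sdiff.1 (Finset.mem_filter.1 he).1
    have hdisj : Disjoint R (Y' \ Y) := by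
      rw [Finset.disjoint_left]
      exact fun e he he' => (hRS e he).2 (Finset.mem_sdiff.1 he').1
    have h5 : (M i).Indep ((R ∪ (Y' \ Y) : Finset V) : Set V) := by
      refine (hS i).subset (Finset.coe_subset.2 (Finset.union_subset (fun e he => (hRS e he).1) ?_))
      intro e he
      rw [Finset.mem_sdiff] at he
      exact (Finset.mem_union.1 (h3 he.1)).resolve_left he.2
    have h6 : ((R ∪ (Y' \ Y) : Finset V) : Set V) ⊆ (M i).closure (Y' : Set V) := by
      intro e he
      rcases Finset.mem_union.1 (Finset.mem_coe.1 he) with he | he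
      · exact (Finset.mem_filter.1 he).2
      · exact (M i).mem_closure_of_mem' (Finset.mem_coe.2 (Finset.mem_sdiff.1 he).1)
          (by simp [hM i])
    have h7 := (h5.encard_le_eRk_of_subset h6).trans
      (((M i).eRk_closure_eq _).le.trans ((M i).eRk_le_encard _))
    simp only [Set.encard_coe_eq_coe_finsetCard, Nat.cast_le] at h7
    rw [Finset.card_union_of_disjoint hdisj] at h7
    have h8 := Finset.card_sdiff_add_card_eq_card h2
    omega
  have h5 : S \ Y' ⊆ ((S \ Y').filter fun e => e ∈ (M 0).closure (Y' : Set V)) ∪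
      ((S \ Y').filter fun e => e ∈ (M 1).closure (Y' : Set V)) := by
    intro e he
    have he' := Finset.mem_sdiff.1 he
    obtain ⟨C, hC, hCt⟩ := exists_test_ne_of_notMem_greedyWith M (commonIndepTest (o := o))
      S.toList Y (Finset.mem_toList.2 he'.1) he'.2
    -- The test failed for an earlier, smaller set, hence it fails for the final one.
    have h6 : ¬ IsCommonIndep M (insert e Y') := fun h =>
      hCt ((run_commonIndepTest M _).2 (h.subset (Finset.insert_subset_insert e hC)))
    have h7 : ∀ i, ¬ (M i).Indep ((insert e Y' : Finset V) : Set V) →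
        e ∈ (M i).closure (Y' : Set V) := by
      intro i hi
      by_contra hcl
      refine hi ?_
      rw [Finset.coe_insert]
      exact ((Matroid.Indep.notMem_closure_iff (h1 i) (by simp [hM i])).1 hcl).1
    simp only [Finset.mem_union, Finset.mem_filter, he, true_and]
    by_contra hcon
    rw [not_or] at hcon
    refine h6 (Fin.forall_fin_two.2 ⟨?_, ?_⟩)
    · exact not_not.1 fun h => hcon.1 (h7 0 h)
    · exact not_not.1 fun h => hcon.2 (h7 1 h)
  have h6 := (Finset.card_le_card h5).trans (Finset.card_union_le _ _)
  have h7 := h4 0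
  have h8 := h4 1
  omega

/-- Solve a sequence of problems and merge the solutions in this order. -/
noncomputable def mergeClasses (solve : ℕ → QueryProgram V o (Finset V)) :
    ℕ → QueryProgram V o (Finset V)
  | 0 => .ret ∅
  | j + 1 => (mergeClasses solve j).bind fun Y => (solve j).bind fun S => mergeInto S Y

lemma cost_mergeClasses_le [Fintype V] (M : Fin 2 → Matroid V)
    (solve : ℕ → QueryProgram V o (Finset V)) (c : ℕ) (hc : ∀ j, (solve j).cost M ≤ c)
    (hS : ∀ j, IsCommonIndep M ((solve j).run M)) (m : ℕ) :
    (mergeClasses solve m).cost M ≤ m * (c + 2 * commonRank M) := by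
  induction m with
  | zero => simp [mergeClasses]
  | succ m ih =>
    simp only [mergeClasses, cost_bind, cost_mergeInto]
    have h1 := (hS m).card_le_commonRank
    have h2 := hc m
    rw [Nat.add_mul]
    omega

/-- If the weights drop quickly from one class to the next, merging loses little. -/
lemma mergeClasses_spec (M : Fin 2 → Matroid V) (hM : IsInstance M)
    (solve : ℕ → QueryProgram V o (Finset V)) (w : V → ℝ) (cls : V → ℕ) (lo hi : ℕ → ℝ) (η : ℝ)
    (hη : 0 ≤ η) (hS : ∀ j, IsCommonIndep M ((solve j).run M))
    (hcls : ∀ j, ∀ e ∈ (solve j).run M, cls e = j)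
    (hlo : ∀ j, ∀ e ∈ (solve j).run M, lo j ≤ w e)
    (hhi : ∀ j, ∀ e ∈ (solve j).run M, w e ≤ hi j) (hhi0 : ∀ j, 0 ≤ hi j)
    (hgap : ∀ j, 2 * hi (j + 1) + η * lo (j + 1) ≤ η * lo j) (m : ℕ) :
    let Y := (mergeClasses solve m).run M
    IsCommonIndep M Y ∧ (∀ e ∈ Y, cls e < m) ∧
      ∑ j ∈ Finset.range m, ∑ e ∈ (solve j).run M, w e + (2 * hi m + η * lo m) * Y.card ≤
        (1 + η) * ∑ e ∈ Y, w e := by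
  induction m with
  | zero => simp [mergeClasses, isCommonIndep_empty]
  | succ m ih =>
    obtain ⟨h1, h2, h3⟩ := ih
    simp only [mergeClasses, run_bind]
    set Y := (mergeClasses solve m).run M
    set S := (solve m).run M with hSm
    obtain ⟨h4, h5, h6, h7⟩ := mergeInto_spec (o := o) M hM S Y (hS m) h1
    set Y' := (mergeInto S Y : QueryProgram V o _).run M
    have haS : ∀ e ∈ Y' \ Y, e ∈ S := by
      intro e he
      rw [Finset.mem_sdiff] at he
      exact (Finset.mem_union.1 (h6 he.1)).resolve_left he.2
    refine ⟨h4, fun e he => ?_, ?_⟩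
    · rcases Finset.mem_union.1 (h6 he) with he | he
      · exact (h2 e he).trans (Nat.lt_succ_self m)
      · exact (hcls m e he).le.trans_lt (Nat.lt_succ_self m)
    · have h8 : S = (Y' \ Y) ∪ (S \ Y') := by
        ext e
        simp only [Finset.mem_union, Finset.mem_sdiff]
        constructor
        · intro he
          by_cases heY' : e ∈ Y'
          · refine Or.inl ⟨heY', fun heY => ?_⟩
            have := h2 e heY
            rw [hcls m e he] at this
            exact this.false
          · exact Or.inr ⟨he, heY'⟩
        · rintro (he | he)
          · exact haS e (Finset.mem_sdiff.2 he)
          · exact he.1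
      have h9 : Disjoint (Y' \ Y) (S \ Y') := by
        rw [Finset.disjoint_left]
        intro e he he'
        exact (Finset.mem_sdiff.1 he').2 (Finset.mem_sdiff.1 he).1
      have h10 : ∑ e ∈ S, w e ≤ ∑ e ∈ Y' \ Y, w e + 2 * Y.card * hi m := by
        rw [h8, Finset.sum_union h9]
        refine add_le_add le_rfl ?_
        calc _ ≤ ∑ e ∈ S \ Y', hi m :=
              Finset.sum_le_sum fun e he => hhi m e (Finset.mem_sdiff.1 he).1
          _ = (S \ Y').card * hi m := by rw [Finset.sum_const, nsmul_eq_mul]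
          _ ≤ 2 * Y.card * hi m :=
              mul_le_mul_of_nonneg_right (by exact_mod_cast h7) (hhi0 m)
      have h11 : lo m * (Y' \ Y).card ≤ ∑ e ∈ Y' \ Y, w e := by
        rw [mul_comm, ← nsmul_eq_mul, ← Finset.sum_const]
        exact Finset.sum_le_sum fun e he => hlo m e (haS e he)
      have h12 : (Y'.card : ℝ) = Y.card + (Y' \ Y).card := by
        rw [← Finset.card_sdiff_add_card_eq_card h5]
        push_cast
        ring
      -- Each element of `Y'` weighs at least `lo m`. A fraction `η` of that is kept in reserve to
      -- pay for the at most two lighter elements it blocks in each later class.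
      have h13 : (2 * hi (m + 1) + η * lo (m + 1)) * (Y'.card : ℝ) ≤ η * lo m * Y'.card :=
        mul_le_mul_of_nonneg_right (hgap m) (Nat.cast_nonneg _)
      have h14 := mul_le_mul_of_nonneg_left h11 hη
      rw [Finset.sum_range_succ, ← hSm, ← Finset.sum_sdiff h5]
      rw [h12] at h13 ⊢
      nlinarith [h3, h10, h13, h14]

end Merge

end QueryProgram

/-! ### Rounded weights in a class -/

/-- The weights of the elements with the property `P`, rounded down to multiples of the unit
`u`. -/
noncomputable def roundedWeight {V : Type} (P : V → Prop) [DecidablePred P] (u : ℝ) (w : V → ℝ)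
    (e : V) : ℕ :=
  if P e then ⌊w e / u⌋₊ else 0

lemma roundedWeight_le {V : Type} (P : V → Prop) [DecidablePred P] {u : ℝ} {w : V → ℝ} {L : ℕ}
    (h : ∀ e, P e → w e / u ≤ L) (e : V) : roundedWeight P u w e ≤ L := by
  unfold roundedWeight
  split_ifs with he
  · exact Nat.floor_le_of_le (h e he)
  · exact Nat.zero_le _

lemma roundedWeight_pos_imp {V : Type} {P : V → Prop} [DecidablePred P] {u : ℝ} {w : V → ℝ} {e : V}
    (h : 0 < roundedWeight P u w e) : P e := by
  by_contra he
  simp [roundedWeight, he] at h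

/-- A good solution for the cardinality problem on the copies gives a good solution for the
weights of the class. -/
lemma QueryProgram.solveByCopies_weight {U V : Type} {o : OracleKind} [Fintype U] [Fintype V]
    [DecidableEq V] (M : Fin 2 → Matroid V) (hM : IsInstance M) {L N : ℕ} (hN : 2 ≤ N) (hL : 0 < L)
    {π : U → V} {idx : U → Fin L} (hinj : ∀ u u', π u = π u' → idx u = idx u' → u = u')
    (hsurj : ∀ (e : V) (k : Fin L), ∃ u, π u = e ∧ idx u = k) (w : V → ℝ) (hw : ∀ e, 0 < w e)
    (P : V → Prop) [DecidablePred P] {u : ℝ} (hu : 0 < u) (hlo : ∀ e, P e → (N : ℝ) ≤ w e / u)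
    (hhi : ∀ e, P e → w e / u ≤ L) (ts : List (QueryTree U o)) (α : ℝ) (hα : 0 ≤ α)
    (hts : ∃ t ∈ ts, IsApproxMaxCard α (unfoldPair M π idx (roundedWeight P u w))
      (t.run (unfoldPair M π idx (roundedWeight P u w))))
    (I : Finset V) (hI : IsCommonIndep M I) :
    α * ((1 - 2 / N) * (1 - 1 / N)) * ∑ e ∈ I.filter P, w e ≤
      ∑ e ∈ (solveByCopies N π idx (roundedWeight P u w) ts).run M, w e := by
  set v := roundedWeight P u w with hv
  have hvL : ∀ e, v e ≤ L := roundedWeight_le P hhi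
  obtain ⟨t, ht, hti, hta⟩ := hts
  -- Only the weight estimate is used, so the sum of all query counts serves as a trivial bound `c`.
  have hspec := (solveByCopies_spec M hM (by omega : 0 < N) hL hinj hvL ts
    (ts.map fun t => t.numQueries (unfoldPair M π idx v)).sum
    (fun t ht => List.single_le_sum (fun _ _ => Nat.zero_le _) _
      (List.mem_map_of_mem (f := fun t => t.numQueries (unfoldPair M π idx v)) ht))).2.2.1 t ht hti
  set S := (solveByCopies N π idx v ts).run M
  obtain ⟨T, hT, hTc⟩ := exists_copies M hinj hsurj hvL (I.filter P)
    (hI.subset (Finset.filter_subset _ _))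
  have h1 := hta T hT
  rw [hTc] at h1
  have hN0 : (0 : ℝ) < N := by exact_mod_cast (by omega : 0 < N)
  have hN2 : (2 : ℝ) ≤ N := by exact_mod_cast hN
  have h2 : ((N : ℝ) - 2) * ((t.run (unfoldPair M π idx v)).card : ℝ) ≤
      N * ((∑ e ∈ S, v e : ℕ) : ℝ) := by
    have : (((N - 2 : ℕ) : ℝ)) = (N : ℝ) - 2 := by push_cast [hN]; ring
    rw [← this]
    exact_mod_cast hspec
  have h3 : ((∑ e ∈ S, v e : ℕ) : ℝ) * u ≤ ∑ e ∈ S, w e := by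
    push_cast
    rw [Finset.sum_mul]
    refine Finset.sum_le_sum fun e _ => ?_
    rw [← le_div_iff₀ hu, hv, roundedWeight]
    split_ifs
    · exact Nat.floor_le (div_pos (hw e) hu).le
    · simpa using (div_pos (hw e) hu).le
  have h4 : (1 - 1 / (N : ℝ)) * ∑ e ∈ I.filter P, w e ≤
      ((∑ e ∈ I.filter P, v e : ℕ) : ℝ) * u := by
    push_cast
    rw [Finset.sum_mul, Finset.mul_sum]
    refine Finset.sum_le_sum fun e he => ?_
    have hPe := (Finset.mem_filter.1 he).2
    rw [← div_le_iff₀ hu, hv, roundedWeight, if_pos hPe]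
    have h5 := Nat.sub_one_lt_floor (w e / u)
    -- Weights in the class are at least `N` units, so rounding down by one unit loses at most a
    -- fraction `1 / N`.
    have h6 : 1 ≤ 1 / (N : ℝ) * (w e / u) := by
      rw [one_div, inv_mul_eq_div, le_div_iff₀ hN0]
      simpa using hlo e hPe
    have h7 : (1 - 1 / (N : ℝ)) * w e / u = w e / u - 1 / (N : ℝ) * (w e / u) := by ring
    rw [h7]
    linarith
  have h8 : 0 ≤ 1 - 2 / (N : ℝ) := by
    rw [sub_nonneg, div_le_one hN0]
    exact hN2
  have h9 : (1 - 2 / (N : ℝ)) * ((t.run (unfoldPair M π idx v)).card : ℝ) ≤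
      ((∑ e ∈ S, v e : ℕ) : ℝ) := by
    have : (1 - 2 / (N : ℝ)) = ((N : ℝ) - 2) / N := by field_simp
    rw [this, div_mul_eq_mul_div, div_le_iff₀ hN0]
    linarith
  calc α * ((1 - 2 / N) * (1 - 1 / N)) * ∑ e ∈ I.filter P, w e
      = α * (1 - 2 / N) * ((1 - 1 / N) * ∑ e ∈ I.filter P, w e) := by ring
    _ ≤ α * (1 - 2 / N) * (((∑ e ∈ I.filter P, v e : ℕ) : ℝ) * u) :=
        mul_le_mul_of_nonneg_left h4 (mul_nonneg hα h8)
    _ = (1 - 2 / N) * (α * ((∑ e ∈ I.filter P, v e : ℕ) : ℝ)) * u := by ring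
    _ ≤ (1 - 2 / N) * ((t.run (unfoldPair M π idx v)).card : ℝ) * u :=
        mul_le_mul_of_nonneg_right (mul_le_mul_of_nonneg_left h1 h8) hu.le
    _ ≤ ((∑ e ∈ S, v e : ℕ) : ℝ) * u := mul_le_mul_of_nonneg_right h9 hu.le
    _ ≤ _ := h3

/-! ### Weight bands -/

section Bands

variable {V : Type}

/-- The band of an element: elements of the same band have the same weight up to a factor
of `b`. -/
noncomputable def weightBand (b : ℕ) (w : V → ℝ) (e : V) : ℕ :=
  Nat.log b ⌊w e / ⨅ e, w e⌋₊

/-- The largest band. -/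
noncomputable def topBand (b : ℕ) (w : V → ℝ) : ℕ :=
  Nat.log b ⌊weightRatio w⌋₊

/-- The classes for the shift `s`: the bands are numbered modulo `N`, one residue class is
deleted, and maximal intervals of the remaining bands form the classes, in decreasing order. -/
def InClass (N : ℕ) (w : V → ℝ) (s j : ℕ) (e : V) : Prop :=
  (weightBand (4 * N) w e + s) % N ≠ 0 ∧
    (weightBand (4 * N) w e + s) / N + j = topBand (4 * N) w + 1

/-- A lower bound on the weights in a class. -/
noncomputable def classLower (N : ℕ) (w : V → ℝ) (s j : ℕ) : ℝ :=
  (⨅ e, w e) * ((4 * N : ℕ) : ℝ) ^ (((topBand (4 * N) w + 1 : ℕ) - j : ℤ) * N + 1 - s : ℤ)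

/-- A class and the deleted band next to it span `N` bands. The exponent is an integer since it may
be negative, for a large shift or for indices `j` beyond the last class, which `mergeClasses_spec`
also ranges over. -/
lemma classLower_succ {w : V → ℝ} {N : ℕ} (hN : 0 < N) (s j : ℕ) :
    classLower N w s (j + 1) * ((4 * N : ℕ) : ℝ) ^ N = classLower N w s j := by
  have h : ((4 * N : ℕ) : ℝ) ≠ 0 := by positivity
  unfold classLower
  rw [mul_assoc, ← zpow_natCast, ← zpow_add₀ h]
  congr 2
  push_cast
  ring

variable [Fintype V] [Nonempty V] {w : V → ℝ}

lemma iInf_weight_pos (hw : ∀ e, 0 < w e) : 0 < ⨅ e, w e := by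
  obtain ⟨e, he⟩ := exists_eq_ciInf_of_finite (f := w)
  rw [← he]
  exact hw e

lemma one_le_div_iInf (hw : ∀ e, 0 < w e) (e : V) : 1 ≤ w e / ⨅ e, w e := by
  rw [le_div_iff₀ (iInf_weight_pos hw), one_mul]
  exact ciInf_le (Set.finite_range w).bddBelow e

lemma div_iInf_le_weightRatio (hw : ∀ e, 0 < w e) (e : V) : w e / ⨅ e, w e ≤ weightRatio w :=
  div_le_div_of_nonneg_right (le_ciSup (Set.finite_range w).bddAbove e) (iInf_weight_pos hw).le

lemma one_le_weightRatio (hw : ∀ e, 0 < w e) : 1 ≤ weightRatio w :=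
  (one_le_div_iInf hw (Classical.arbitrary V)).trans (div_iInf_le_weightRatio hw _)

lemma weightBand_le_topBand (b : ℕ) (hw : ∀ e, 0 < w e) (e : V) :
    weightBand b w e ≤ topBand b w :=
  Nat.log_mono_right (Nat.floor_le_floor (div_iInf_le_weightRatio hw e))

lemma topBand_le_log {b : ℕ} (hb : 4 ≤ b) (hw : ∀ e, 0 < w e) :
    (topBand b w : ℝ) ≤ Real.log (weightRatio w) := by
  have h1 := one_le_weightRatio hw
  have h2 : ((b : ℝ) ^ topBand b w) ≤ weightRatio w := by
    have h3 : b ^ topBand b w ≤ ⌊weightRatio w⌋₊ :=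
      Nat.pow_log_le_self b (Nat.floor_pos.2 h1).ne'
    calc ((b : ℝ) ^ topBand b w) ≤ (⌊weightRatio w⌋₊ : ℝ) := by exact_mod_cast h3
      _ ≤ _ := Nat.floor_le (by linarith)
  -- Since `b ≥ 4 > e`, each band accounts for at least one unit of the natural logarithm.
  have h4 : (1 : ℝ) ≤ Real.log b := by
    rw [Real.le_log_iff_exp_le (by exact_mod_cast (by omega : 0 < b))]
    have : (4 : ℝ) ≤ b := by exact_mod_cast hb
    linarith [Real.exp_one_lt_d9]
  calc (topBand b w : ℝ) ≤ topBand b w * Real.log b :=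
        le_mul_of_one_le_right (Nat.cast_nonneg _) h4
    _ = Real.log ((b : ℝ) ^ topBand b w) := (Real.log_pow _ _).symm
    _ ≤ _ := Real.log_le_log (by have : 0 < b := by omega
                                 positivity) h2

lemma weightBand_bounds {b : ℕ} (hb : 1 < b) (hw : ∀ e, 0 < w e) (e : V) :
    (⨅ e, w e) * (b : ℝ) ^ weightBand b w e ≤ w e ∧
      w e ≤ (⨅ e, w e) * (b : ℝ) ^ (weightBand b w e + 1) := by
  have h0 := iInf_weight_pos hw
  have h1 := one_le_div_iInf hw e
  constructor
  · rw [mul_comm, ← le_div_iff₀ h0]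
    have h3 : b ^ weightBand b w e ≤ ⌊w e / ⨅ e, w e⌋₊ :=
      Nat.pow_log_le_self b (Nat.floor_pos.2 h1).ne'
    calc ((b : ℝ) ^ weightBand b w e) ≤ (⌊w e / ⨅ e, w e⌋₊ : ℝ) := by exact_mod_cast h3
      _ ≤ _ := Nat.floor_le (by linarith)
  · rw [mul_comm, ← div_le_iff₀ h0]
    have h3 : ⌊w e / ⨅ e, w e⌋₊ + 1 ≤ b ^ (weightBand b w e + 1) :=
      Nat.lt_pow_succ_log_self hb _
    refine (Nat.lt_floor_add_one _).le.trans ?_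
    exact_mod_cast h3

lemma classLower_pos {N : ℕ} (hN : 0 < N) (hw : ∀ e, 0 < w e) (s j : ℕ) :
    0 < classLower N w s j := by
  have := iInf_weight_pos hw
  unfold classLower
  positivity

/-- The residues in a class run from `1` to `N - 1`, so its weights spread over only `N - 1` bands.
The missing band is the gap to the next class. -/
lemma InClass.bounds {N : ℕ} (hN : 0 < N) (hw : ∀ e, 0 < w e) {s j : ℕ} {e : V}
    (he : InClass N w s j e) :
    classLower N w s j ≤ w e ∧ w e ≤ classLower N w s j * ((4 * N : ℕ) : ℝ) ^ (N - 1) := by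
  obtain ⟨he1, he2⟩ := he
  obtain ⟨h1, h2⟩ := weightBand_bounds (b := 4 * N) (by omega) hw e
  have h0 := iInf_weight_pos hw
  have hb : (1 : ℝ) ≤ ((4 * N : ℕ) : ℝ) := by exact_mod_cast (by omega : 1 ≤ 4 * N)
  have hdm := Nat.div_add_mod (weightBand (4 * N) w e + s) N
  have hlt := Nat.mod_lt (weightBand (4 * N) w e + s) hN
  set β := weightBand (4 * N) w e
  set g := (β + s) / N
  set r := (β + s) % N
  have hg : ((topBand (4 * N) w + 1 : ℕ) - j : ℤ) = g := by rw [← he2]; push_cast; ring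
  have hdm' : (N : ℤ) * g + r = β + s := by exact_mod_cast hdm
  have hcl : classLower N w s j = (⨅ e, w e) * ((4 * N : ℕ) : ℝ) ^ ((g : ℤ) * N + 1 - s) := by
    rw [classLower, hg]
  have hr1 : (1 : ℤ) ≤ r := by exact_mod_cast Nat.one_le_iff_ne_zero.2 he1
  have hr2 : (r : ℤ) + 1 ≤ N := by exact_mod_cast hlt
  have hcomm : (g : ℤ) * N = N * g := mul_comm _ _
  constructor
  · refine le_trans ?_ h1
    rw [hcl, ← zpow_natCast]
    refine mul_le_mul_of_nonneg_left (zpow_le_zpow_right₀ hb ?_) h0.le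
    rw [hcomm]
    linarith
  · refine h2.trans ?_
    rw [hcl, mul_assoc, ← zpow_natCast, ← zpow_natCast, ← zpow_add₀ (by positivity)]
    refine mul_le_mul_of_nonneg_left (zpow_le_zpow_right₀ hb ?_) h0.le
    rw [hcomm]
    push_cast [Nat.cast_sub hN]
    linarith

end Bands

/-! ### The weighted algorithm for given query trees -/

open Classical in
/-- The integer weights of the elements of a class. -/
noncomputable def classWeight {V : Type} (N : ℕ) (w : V → ℝ) (s j : ℕ) : V → ℕ :=
  roundedWeight (InClass N w s j) (classLower N w s j / N) w

/-- The number of copies of each element. -/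
def numCopies (N : ℕ) : ℕ := N * (4 * N) ^ N

/-- One of the query trees solves the cardinality problem for the copies of a class. -/
def ClassSolved {U V : Type} {o : OracleKind} {L : ℕ} (α : ℝ) (M : Fin 2 → Matroid V) (π : U → V)
    (idx : U → Fin L) (N : ℕ) (w : V → ℝ) (s j : ℕ) (ts : List (QueryTree U o)) : Prop :=
  ∃ t ∈ ts, IsApproxMaxCard α (unfoldPair M π idx (classWeight N w s j))
    (t.run (unfoldPair M π idx (classWeight N w s j)))

namespace QueryProgram

variable {U V : Type} {o : OracleKind} [DecidableEq V] {N : ℕ}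

/-- The solution for the classes of the shift `s`. -/
noncomputable def shiftProgram (N : ℕ) (π : U → V) (idx : U → Fin (numCopies N)) (w : V → ℝ)
    (ts : List (QueryTree U o)) (s : ℕ) : QueryProgram V o (Finset V) :=
  mergeClasses (fun j => solveByCopies N π idx (classWeight N w s j) ts)
    (topBand (4 * N) w + 2)

/-- The best solution over all shifts. -/
noncomputable def weightedProgram (N : ℕ) (π : U → V) (idx : U → Fin (numCopies N)) (w : V → ℝ)
    (ts : List (QueryTree U o)) : QueryProgram V o (Finset V) :=
  (mapList (shiftProgram N π idx w ts) (List.range N)).bind fun l =>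
    .ret (bestBy (fun S => ∑ e ∈ S, w e) ∅ l)

end QueryProgram

lemma numCopies_pos (hN : 0 < N) : 0 < numCopies N := by
  unfold numCopies
  positivity

section Classes

variable {V : Type} {N : ℕ} {w : V → ℝ}

/-- Some shift deletes only a small part of the weight. -/
lemma exists_shift (hN : 0 < N) (hw : ∀ e, 0 < w e) (I : Finset V) :
    ∃ s < N, ∑ e ∈ I.filter (fun e => (weightBand (4 * N) w e + s) % N = 0), w e ≤
      (∑ e ∈ I, w e) / N := by
  have hN0 : (N : ℝ) ≠ 0 := by exact_mod_cast hN.ne'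
  have h : ∑ s ∈ Finset.range N,
      ∑ e ∈ I.filter (fun e => (weightBand (4 * N) w e + s) % N = 0), w e ≤
      ∑ s ∈ Finset.range N, (∑ e ∈ I, w e) / N := by
    simp_rw [Finset.sum_filter]
    rw [Finset.sum_comm, Finset.sum_const, Finset.card_range, nsmul_eq_mul, mul_div_cancel₀ _ hN0]
    refine Finset.sum_le_sum fun e _ => ?_
    rw [← Finset.sum_filter, Finset.sum_const, nsmul_eq_mul]
    refine mul_le_of_le_one_left (hw e).le ?_
    -- Each element is deleted by at most one shift, so the average deleted weight is at most a
    -- fraction `1 / N`.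
    have : (Finset.filter (fun s => (weightBand (4 * N) w e + s) % N = 0)
        (Finset.range N)).card ≤ 1 := by
      rw [Finset.card_le_one]
      intro s hs s' hs'
      simp only [Finset.mem_filter, Finset.mem_range] at hs hs'
      have h1 : weightBand (4 * N) w e + s ≡ weightBand (4 * N) w e + s' [MOD N] :=
        hs.2.trans hs'.2.symm
      exact (Nat.ModEq.add_left_cancel' _ h1).eq_of_lt_of_lt hs.1 hs'.1
    exact_mod_cast this
  obtain ⟨s, hs, hs'⟩ := Finset.exists_le_of_sum_le (Finset.nonempty_range_iff.2 hN.ne') h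
  exact ⟨s, Finset.mem_range.1 hs, hs'⟩

variable [Fintype V] [Nonempty V]

lemma InClass.div_unit_bounds (hN : 0 < N) (hw : ∀ e, 0 < w e) {s j : ℕ} {e : V}
    (he : InClass N w s j e) :
    (N : ℝ) ≤ w e / (classLower N w s j / N) ∧
      w e / (classLower N w s j / N) ≤ (numCopies N : ℕ) := by
  obtain ⟨h1, h2⟩ := he.bounds hN hw
  have h0 := classLower_pos hN hw s j
  have hN0 : (0 : ℝ) < N := by exact_mod_cast hN
  have hb : (1 : ℝ) ≤ ((4 * N : ℕ) : ℝ) := by exact_mod_cast (by omega : 1 ≤ 4 * N)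
  constructor
  · rw [le_div_iff₀ (by positivity)]
    field_simp
    exact h1
  · rw [div_le_iff₀ (by positivity), numCopies]
    calc w e ≤ classLower N w s j * ((4 * N : ℕ) : ℝ) ^ (N - 1) := h2
      _ ≤ classLower N w s j * ((4 * N : ℕ) : ℝ) ^ N :=
          mul_le_mul_of_nonneg_left (pow_le_pow_right₀ hb (Nat.sub_le _ _)) h0.le
      _ = _ := by push_cast; field_simp

open Classical in
lemma classWeight_le (hN : 0 < N) (hw : ∀ e, 0 < w e) (s j : ℕ) (e : V) :
    classWeight N w s j e ≤ numCopies N :=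
  roundedWeight_le _ (fun _ he => (he.div_unit_bounds hN hw).2) e

open Classical in
-- The deleted elements and the classes partition `I`; as `s < N`, a shift adds at most one to the
-- quotient, so `topBand + 2` classes suffice.
lemma sum_inClass (hN : 0 < N) (hw : ∀ e, 0 < w e) {s : ℕ} (hs : s < N) (I : Finset V) :
    ∑ j ∈ Finset.range (topBand (4 * N) w + 2), ∑ e ∈ I.filter (InClass N w s j), w e +
      ∑ e ∈ I.filter (fun e => (weightBand (4 * N) w e + s) % N = 0), w e = ∑ e ∈ I, w e := by
  simp_rw [Finset.sum_filter]
  rw [Finset.sum_comm, ← Finset.sum_add_distrib]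
  refine Finset.sum_congr rfl fun e _ => ?_
  by_cases h : (weightBand (4 * N) w e + s) % N = 0
  · simp [InClass, h]
  · have h1 := weightBand_le_topBand (4 * N) hw e
    have h2 : (weightBand (4 * N) w e + s) / N ≤ topBand (4 * N) w + 1 := by
      rw [← Nat.lt_succ_iff, Nat.div_lt_iff_lt_mul hN]
      nlinarith
    generalize hg : (weightBand (4 * N) w e + s) / N = g at h2
    rw [if_neg h, add_zero,
      Finset.sum_eq_single (topBand (4 * N) w + 1 - g)]
    · exact if_pos ⟨h, by rw [hg]; omega⟩
    · intro j _ hj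
      refine if_neg fun hc => hj ?_
      have := hc.2
      rw [hg] at this
      omega
    · intro hj
      refine absurd (Finset.mem_range.2 ?_) hj
      omega

end Classes

section Weighted

variable {U V : Type} {o : OracleKind} [Fintype V] [DecidableEq V] [Nonempty V] {N : ℕ}
  {π : U → V} {idx : U → Fin (numCopies N)} {w : V → ℝ}

lemma shiftProgram_cost_le (M : Fin 2 → Matroid V) (hM : IsInstance M) (hN : 0 < N)
    (hinj : ∀ u u', π u = π u' → idx u = idx u' → u = u') (hw : ∀ e, 0 < w e)
    (ts : List (QueryTree U o)) (c s : ℕ)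
    (hc : ∀ j, ∀ t ∈ ts, t.numQueries (unfoldPair M π idx (classWeight N w s j)) ≤ c) :
    (QueryProgram.shiftProgram N π idx w ts s).cost M ≤ (topBand (4 * N) w + 2) *
      ((numCopies N * (ts.length * (c + 2)) + QueryProgram.auctionLength N (numCopies N) *
        (4 * numCopies N * commonRank M)) + 2 * commonRank M) := by
  have h := fun j => QueryProgram.solveByCopies_spec M hM hN (numCopies_pos hN) hinj
    (classWeight_le hN hw s j) ts c (hc j)
  exact QueryProgram.cost_mergeClasses_le M _ _ (fun j => (h j).2.2.2) (fun j => (h j).1) _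

lemma weightedProgram_cost_le (M : Fin 2 → Matroid V) (hM : IsInstance M) (hN : 0 < N)
    (hinj : ∀ u u', π u = π u' → idx u = idx u' → u = u') (hw : ∀ e, 0 < w e)
    (ts : List (QueryTree U o)) (c : ℕ)
    (hc : ∀ s j, ∀ t ∈ ts, t.numQueries (unfoldPair M π idx (classWeight N w s j)) ≤ c) :
    (QueryProgram.weightedProgram N π idx w ts).cost M ≤ N * ((topBand (4 * N) w + 2) *
      ((numCopies N * (ts.length * (c + 2)) + QueryProgram.auctionLength N (numCopies N) *
        (4 * numCopies N * commonRank M)) + 2 * commonRank M)) := by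
  simp only [QueryProgram.weightedProgram, QueryProgram.cost_bind, QueryProgram.cost_ret,
    Nat.add_zero, QueryProgram.cost_mapList]
  have h := List.sum_le_card_nsmul
    ((List.range N).map fun s => (QueryProgram.shiftProgram N π idx w ts s).cost M) _ fun x hx => by
      obtain ⟨s, -, rfl⟩ := List.mem_map.1 hx
      exact shiftProgram_cost_le M hM hN hinj hw ts c s (hc s)
  rwa [List.length_map, List.length_range, smul_eq_mul] at h

open Classical in
lemma shiftProgram_spec (M : Fin 2 → Matroid V) (hM : IsInstance M) (hN : 2 ≤ N)
    (hinj : ∀ u u', π u = π u' → idx u = idx u' → u = u')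
    (hw : ∀ e, 0 < w e)
    (ts : List (QueryTree U o)) (s : ℕ) :
    let Y := (QueryProgram.shiftProgram N π idx w ts s).run M
    IsCommonIndep M Y ∧ ∑ j ∈ Finset.range (topBand (4 * N) w + 2),
      ∑ e ∈ (QueryProgram.solveByCopies N π idx (classWeight N w s j) ts).run M, w e ≤
        (1 + 1 / N) * ∑ e ∈ Y, w e := by
  intro Y
  have hN' : 0 < N := by omega
  have hN0 : (0 : ℝ) < N := by exact_mod_cast hN'
  have h := fun j => QueryProgram.solveByCopies_spec M hM hN' (numCopies_pos hN') hinj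
    (classWeight_le hN' hw s j) ts
    (ts.map fun t => t.numQueries (unfoldPair M π idx (classWeight N w s j))).sum
    (fun t ht => List.single_le_sum (fun _ _ => Nat.zero_le _) _
      (List.mem_map_of_mem
        (f := fun t => t.numQueries (unfoldPair M π idx (classWeight N w s j))) ht))
  have hin : ∀ j, ∀ e ∈ (QueryProgram.solveByCopies N π idx (classWeight N w s j) ts).run M,
      InClass N w s j e := fun j e he => roundedWeight_pos_imp ((h j).2.1 e he)
  have hpos := classLower_pos hN' hw s
  have hspec := QueryProgram.mergeClasses_spec M hM
    (fun j => QueryProgram.solveByCopies N π idx (classWeight N w s j) ts) w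
    (fun e => topBand (4 * N) w + 1 - (weightBand (4 * N) w e + s) / N) (classLower N w s)
    (fun j => classLower N w s j * ((4 * N : ℕ) : ℝ) ^ (N - 1)) (1 / N) (by positivity)
    (fun j => (h j).1) (fun j e he => by have := (hin j e he).2; omega)
    (fun j e he => ((hin j e he).bounds hN' hw).1)
    (fun j e he => ((hin j e he).bounds hN' hw).2)
    (fun j => mul_nonneg (hpos j).le (by positivity)) ?_ (topBand (4 * N) w + 2)
  · refine ⟨hspec.1, le_trans (le_add_of_nonneg_right ?_) hspec.2.2⟩
    have := hpos (topBand (4 * N) w + 2)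
    positivity
  · intro j
    have h1 := classLower_succ (w := w) hN' s j
    have h2 : ((4 * N : ℕ) : ℝ) ^ N = ((4 * N : ℕ) : ℝ) ^ (N - 1) * (4 * N) := by
      rw [← pow_sub_one_mul hN'.ne']
      push_cast
      ring
    have h3 : (1 : ℝ) ≤ ((4 * N : ℕ) : ℝ) ^ (N - 1) :=
      one_le_pow₀ (by exact_mod_cast (by omega : 1 ≤ 4 * N))
    rw [← h1, h2]
    have h4 := hpos (j + 1)
    set x := classLower N w s (j + 1)
    set y := ((4 * N : ℕ) : ℝ) ^ (N - 1)
    -- This is where the base `4 * N` matters: with `η = 1 / N` the gap leaves four times the upper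
    -- end of the lighter class, and three times are needed.
    have h5 : 1 / (N : ℝ) * (x * (y * (4 * N))) = 4 * (x * y) := by field_simp
    have h6 : 1 / (N : ℝ) * x ≤ x * y := by
      rw [mul_comm]
      refine mul_le_mul_of_nonneg_left (le_trans ?_ h3) h4.le
      rw [div_le_one hN0]
      exact_mod_cast hN'
    rw [h5]
    nlinarith [mul_pos h4 (lt_of_lt_of_le one_pos h3)]

open Classical in
/-- If the classes that have not been solved have small weight, the output is good. -/
lemma weightedProgram_spec [Fintype U] (M : Fin 2 → Matroid V) (hM : IsInstance M) (hN : 2 ≤ N)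
    (hinj : ∀ u u', π u = π u' → idx u = idx u' → u = u')
    (hsurj : ∀ (e : V) (k : Fin (numCopies N)), ∃ u, π u = e ∧ idx u = k) (hw : ∀ e, 0 < w e)
    (ts : List (QueryTree U o)) {α : ℝ} (hα : 0 ≤ α) {s : ℕ} (hs : s < N) (I : Finset V)
    (hI : IsCommonIndep M I)
    (hdel : ∑ e ∈ I.filter (fun e => (weightBand (4 * N) w e + s) % N = 0), w e ≤
      (∑ e ∈ I, w e) / N)
    (hfail : ∑ j ∈ Finset.range (topBand (4 * N) w + 2) with
      ¬ ClassSolved α M π idx N w s j ts, ∑ e ∈ I.filter (InClass N w s j), w e ≤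
        (∑ e ∈ I, w e) / N) :
    IsCommonIndep M ((QueryProgram.weightedProgram N π idx w ts).run M) ∧
    α * (1 - 6 / N) * ∑ e ∈ I, w e ≤
      ∑ e ∈ (QueryProgram.weightedProgram N π idx w ts).run M, w e := by
  have hN' : 0 < N := by omega
  have hN0 : (0 : ℝ) < N := by exact_mod_cast hN'
  have hN2 : (2 : ℝ) ≤ N := by exact_mod_cast hN
  have hrun : (QueryProgram.weightedProgram N π idx w ts).run M =
      bestBy (fun S => ∑ e ∈ S, w e) ∅
        ((List.range N).map fun s => (QueryProgram.shiftProgram N π idx w ts s).run M) := by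
    simp [QueryProgram.weightedProgram]
  have hspec := fun s => shiftProgram_spec M hM hN hinj hw ts s
  rw [hrun]
  constructor
  · rcases bestBy_mem (fun S => ∑ e ∈ S, w e) ∅
      ((List.range N).map fun s => (QueryProgram.shiftProgram N π idx w ts s).run M) with h | h
    · rw [h]
      exact isCommonIndep_empty M
    · obtain ⟨s, -, hs⟩ := List.mem_map.1 h
      rw [← hs]
      exact (hspec s).1
  · refine le_trans ?_ (le_bestBy (fun S => ∑ e ∈ S, w e) ∅ _ _
      (List.mem_map_of_mem (List.mem_range.2 hs)))
    set Y := (QueryProgram.shiftProgram N π idx w ts s).run M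
    set A := ∑ e ∈ I, w e
    have hA : 0 ≤ A := Finset.sum_nonneg fun e _ => (hw e).le
    set κ : ℝ := (1 - 2 / N) * (1 - 1 / N) with hκ
    set a : ℕ → ℝ := fun j => ∑ e ∈ I.filter (InClass N w s j), w e with ha
    set J := Finset.range (topBand (4 * N) w + 2)
    have h1 : ∑ j ∈ J with ClassSolved α M π idx N w s j ts, α * κ * a j ≤
        ∑ j ∈ J, ∑ e ∈ (QueryProgram.solveByCopies N π idx (classWeight N w s j) ts).run M,
          w e := by
      refine le_trans (Finset.sum_le_sum fun j hj => ?_)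
        (Finset.sum_le_sum_of_subset_of_nonneg (Finset.filter_subset _ _)
          fun j _ _ => Finset.sum_nonneg fun e _ => (hw e).le)
      exact QueryProgram.solveByCopies_weight M hM hN (numCopies_pos hN') hinj hsurj w hw
        (InClass N w s j) (div_pos (classLower_pos hN' hw s j) hN0)
        (fun e he => (he.div_unit_bounds hN' hw).1) (fun e he => (he.div_unit_bounds hN' hw).2)
        ts α hα (Finset.mem_filter.1 hj).2 I hI
    have h2 := sum_inClass hN' hw hs I
    have h3 := Finset.sum_filter_add_sum_filter_not J
      (fun j => ClassSolved α M π idx N w s j ts) a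
    rw [← Finset.mul_sum] at h1
    have h4 : A * (1 - 2 / N) ≤ ∑ j ∈ J with ClassSolved α M π idx N w s j ts, a j := by
      have h5 : A * (1 - 2 / N) = A - A / N - A / N := by ring
      rw [h5]
      change ∑ j ∈ J, a j + _ = A at h2
      change ∑ j ∈ J with ¬ ClassSolved α M π idx N w s j ts, a j ≤ A / N at hfail
      linarith
    have h6 : (1 : ℝ) / N ≤ 1 / 2 := by
      rw [div_le_div_iff₀ hN0 two_pos]
      linarith
    set x : ℝ := 1 / N with hx
    have hx0 : 0 ≤ x := by positivity
    have e2 : (2 : ℝ) / N = 2 * x := by rw [hx]; ring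
    have e6 : (6 : ℝ) / N = 6 * x := by rw [hx]; ring
    rw [e2] at h4 hκ
    rw [e6]
    have hκ0 : 0 ≤ κ := by
      rw [hκ]
      exact mul_nonneg (by linarith) (by linarith)
    have h7 : α * κ * (A * (1 - 2 * x)) ≤ (1 + x) * ∑ e ∈ Y, w e :=
      (mul_le_mul_of_nonneg_left h4 (mul_nonneg hα hκ0)).trans (h1.trans (hspec s).2)
    -- Six losses of about `1 / N`: two from the auction, one each from rounding, deletion, unsolved
    -- classes and merging.
    have h8 : (1 - 6 * x) * (1 + x) ≤ κ * (1 - 2 * x) := by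
      rw [hκ]
      nlinarith [mul_nonneg hx0 hx0, mul_nonneg (mul_nonneg hx0 hx0) (by linarith : 0 ≤ 1 / 2 - x)]
    have h9 := mul_le_mul_of_nonneg_left h8 (mul_nonneg hα hA)
    refine le_of_mul_le_mul_left ?_ (by linarith : (0 : ℝ) < 1 + x)
    calc (1 + x) * (α * (1 - 6 * x) * A) = α * A * ((1 - 6 * x) * (1 + x)) := by ring
      _ ≤ α * A * (κ * (1 - 2 * x)) := h9
      _ = α * κ * (A * (1 - 2 * x)) := by ring
      _ ≤ _ := h7

end Weighted

/-! ### Independent samples -/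

namespace PMF

variable {α : Type}

/-- A list of `k` independent samples. -/
noncomputable def samples (p : PMF α) : ℕ → PMF (List α)
  | 0 => PMF.pure []
  | k + 1 => p.bind fun a => (samples p k).map (a :: ·)

lemma mem_support_samples (p : PMF α) (k : ℕ) {l : List α} (hl : l ∈ (p.samples k).support) :
    l.length = k ∧ ∀ a ∈ l, a ∈ p.support := by
  induction k generalizing l with
  | zero =>
    rw [samples, PMF.mem_support_pure_iff] at hl
    simp [hl]
  | succ k ih =>
    rw [samples, PMF.mem_support_bind_iff] at hl
    obtain ⟨a, ha, hl⟩ := hl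
    rw [PMF.mem_support_map_iff] at hl
    obtain ⟨l', hl', rfl⟩ := hl
    obtain ⟨h1, h2⟩ := ih hl'
    refine ⟨by simp [h1], fun b hb => ?_⟩
    rcases List.mem_cons.1 hb with rfl | hb
    · exact ha
    · exact h2 b hb

lemma samples_pure (a : α) (k : ℕ) :
    (PMF.pure a).samples k = PMF.pure (List.replicate k a) := by
  induction k with
  | zero => rfl
  | succ k ih => rw [samples, PMF.pure_bind, ih, PMF.pure_map, List.replicate_succ]

lemma toOuterMeasure_samples_le (p : PMF α) (G : Set α) (k : ℕ) :
    (p.samples k).toOuterMeasure {l | ∀ a ∈ l, a ∉ G} ≤ (p.toOuterMeasure Gᶜ) ^ k := by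
  classical
  induction k with
  | zero =>
    rw [samples, PMF.toOuterMeasure_pure_apply, pow_zero]
    split_ifs <;> simp
  | succ k ih =>
    rw [samples, PMF.toOuterMeasure_bind_apply, pow_succ', PMF.toOuterMeasure_apply p Gᶜ,
      ← ENNReal.tsum_mul_right]
    refine ENNReal.tsum_le_tsum fun a => ?_
    rw [PMF.toOuterMeasure_map_apply]
    by_cases ha : a ∈ G
    · have : ((a :: ·) ⁻¹' {l : List α | ∀ a ∈ l, a ∉ G}) = ∅ := by
        ext l
        simp [ha]
      rw [this]
      simp
    · have : ((a :: ·) ⁻¹' {l : List α | ∀ a ∈ l, a ∉ G}) = {l | ∀ a ∈ l, a ∉ G} := by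
        ext l
        simp [ha]
      rw [this, Set.indicator_of_mem (by simpa using ha)]
      exact (mul_le_mul_right ih _).trans_eq (by rw [PMF.toOuterMeasure_apply p Gᶜ])

lemma toOuterMeasure_add_compl (p : PMF α) (s : Set α) :
    p.toOuterMeasure s + p.toOuterMeasure sᶜ = 1 := by
  rw [PMF.toOuterMeasure_apply, PMF.toOuterMeasure_apply, ← ENNReal.tsum_add, ← p.tsum_coe]
  exact tsum_congr fun a => congrFun (Set.indicator_self_add_compl s p) a

lemma toOuterMeasure_compl_le (p : PMF α) {s : Set α} {x : ENNReal}
    (h : x ≤ p.toOuterMeasure s) : p.toOuterMeasure sᶜ ≤ 1 - x := by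
  rw [← p.toOuterMeasure_add_compl s]
  refine ENNReal.le_sub_of_add_le_left (ne_top_of_le_ne_top ?_ h) (add_le_add h le_rfl)
  exact ne_top_of_le_ne_top ENNReal.one_ne_top
    (le_self_add.trans_eq (p.toOuterMeasure_add_compl s))

lemma toOuterMeasure_le_one (p : PMF α) (s : Set α) : p.toOuterMeasure s ≤ 1 :=
  le_self_add.trans_eq (p.toOuterMeasure_add_compl s)

open Classical in
/-- Markov's inequality for a weighted sum of indicators. -/
lemma mul_toOuterMeasure_le {ι : Type} (p : PMF α) (J : Finset ι) (a : ι → ENNReal)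
    (F : ι → Set α) (c : ENNReal) (B : Set α)
    (hB : ∀ x ∈ B, c ≤ ∑ j ∈ J with x ∈ F j, a j) :
    c * p.toOuterMeasure B ≤ ∑ j ∈ J, a j * p.toOuterMeasure (F j) := by
  simp_rw [PMF.toOuterMeasure_apply, ← ENNReal.tsum_mul_left]
  rw [← Summable.tsum_finsetSum fun _ _ => ENNReal.summable]
  refine ENNReal.tsum_le_tsum fun x => ?_
  by_cases hx : x ∈ B
  · rw [Set.indicator_of_mem hx]
    calc c * p x ≤ (∑ j ∈ J with x ∈ F j, a j) * p x := mul_le_mul_left (hB x hx) _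
      _ = ∑ j ∈ J, a j * (F j).indicator p x := by
        rw [Finset.sum_mul, Finset.sum_filter]
        refine Finset.sum_congr rfl fun j _ => ?_
        by_cases h : x ∈ F j <;> simp [h]
  · simp [hx]

end PMF

/-- Since `N ≤ 3 ^ N`, the first `N` samples absorb the factor `N` from Markov's inequality, and the
last one leaves the original failure probability `q`. -/
lemma ENNReal.mul_pow_succ_le_self {q : ENNReal} (hq : q ≤ 1 / 3) (N : ℕ) :
    (N : ENNReal) * q ^ (N + 1) ≤ q := by
  rw [pow_succ, ← mul_assoc]
  refine mul_le_of_le_one_left zero_le ?_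
  calc (N : ENNReal) * q ^ N ≤ (3 ^ N : ℕ) * (1 / 3) ^ N := by
        gcongr
        exact (Nat.lt_pow_self (by norm_num)).le
    _ = 1 := by
        push_cast
        rw [← mul_pow, one_div, ENNReal.mul_inv_cancel (by norm_num) (by norm_num), one_pow]

/-! ### Lower bounds for cardinality algorithms -/

section LowerBound

variable {o : OracleKind} {Au : UnweightedAlg o} {T : ℕ → ℕ → ℝ}

lemma commonRank_loopyOn (n : ℕ) :
    commonRank (fun _ : Fin 2 => Matroid.loopyOn (Set.univ : Set (Fin n))) = 0 := by
  classical
  unfold commonRank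
  rw [← bot_eq_zero, Finset.sup_eq_bot_iff]
  intro S hS
  have := (Finset.mem_filter.1 hS).2 0
  rw [Matroid.loopyOn_indep_iff] at this
  simp [Finset.coe_eq_empty.1 this]

lemma UnweightedAlg.numQueries_loopyOn_le (hT : Au.QueriesAtMost T)
    (hmono : ∀ n n' r r' : ℕ, n ≤ n' → r ≤ r' → T n r ≤ T n' r') (n r : ℕ)
    {t : QueryTree (Fin n) o} (ht : t ∈ (Au n).support) :
    (t.numQueries (fun _ : Fin 2 => Matroid.loopyOn (Set.univ : Set (Fin n))) : ℝ) ≤ T n r := by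
  refine (hT n _ (fun _ => rfl) t ht).trans ?_
  rw [commonRank_loopyOn]
  exact hmono _ _ _ _ le_rfl (Nat.zero_le _)

lemma UnweightedAlg.bound_nonneg (hT : Au.QueriesAtMost T)
    (hmono : ∀ n n' r r' : ℕ, n ≤ n' → r ≤ r' → T n r ≤ T n' r') (n r : ℕ) : 0 ≤ T n r := by
  obtain ⟨t, ht⟩ := (Au n).support_nonempty
  exact (Nat.cast_nonneg _).trans (numQueries_loopyOn_le hT hmono n r ht)

/-- Without queries one cannot distinguish the matroid of rank zero from the free matroid. -/
lemma UnweightedAlg.one_le_bound {α : ℝ} {p : ENNReal} (hα : 0 < α) (hp : 2 / 3 ≤ p)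
    (hA : Au.Approximates α p) (hT : Au.QueriesAtMost T)
    (hmono : ∀ n n' r r' : ℕ, n ≤ n' → r ≤ r' → T n r ≤ T n' r') {n : ℕ} (hn : 0 < n) (r : ℕ) :
    1 ≤ T n r := by
  by_contra hlt
  rw [not_le] at hlt
  set M₀ : Fin 2 → Matroid (Fin n) := fun _ => Matroid.loopyOn Set.univ
  set M₁ : Fin 2 → Matroid (Fin n) := fun _ => Matroid.freeOn Set.univ
  have h0 := hA n M₀ fun _ => rfl
  have h1 := hA n M₁ fun _ => rfl
  -- A tree without queries has the same output on both instances; only `∅` is correct on the loops,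
  -- and it is wrong on the free matroid. The two success events are thus disjoint on the support,
  -- although each has probability at least `2 / 3`.
  have h2 : (Au n).toOuterMeasure {t | IsApproxMaxCard α M₁ (t.run M₁)} ≤
      (Au n).toOuterMeasure {t | IsApproxMaxCard α M₀ (t.run M₀)}ᶜ := by
    refine PMF.toOuterMeasure_mono _ ?_
    rintro t ⟨ht1, hts⟩ ht0
    have hq : t.numQueries M₀ = 0 := by
      have := (numQueries_loopyOn_le hT hmono n r hts).trans_lt hlt
      exact Nat.lt_one_iff.1 (by exact_mod_cast this)
    cases t with
    | output S =>
      have hS : S = ∅ := by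
        have := ht0.1 0
        rw [Matroid.loopyOn_indep_iff] at this
        exact Finset.coe_eq_empty.1 this
      have h3 := ht1.2 Finset.univ fun i => by simp [M₁]
      simp only [QueryTree.run, hS, Finset.card_empty, Nat.cast_zero, Finset.card_univ,
        Fintype.card_fin] at h3
      have : (0 : ℝ) < α * n := by positivity
      linarith
    | query i S next => simp [QueryTree.numQueries] at hq
  have h3 := h1.trans (h2.trans ((Au n).toOuterMeasure_compl_le h0))
  have h4 : (2 / 3 : ENNReal) ≤ 1 - 2 / 3 := hp.trans (h3.trans (tsub_le_tsub_left hp 1))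
  have h5 : (2 / 3 : ENNReal) = ENNReal.ofReal (2 / 3) := by
    rw [ENNReal.ofReal_div_of_pos (by norm_num)]
    norm_num
  rw [h5, ← ENNReal.ofReal_one, ← ENNReal.ofReal_sub _ (by norm_num),
    ENNReal.ofReal_le_ofReal_iff (by norm_num)] at h4
  norm_num at h4

end LowerBound

/-! ### The reduction -/

/-- The element of which `u` is a copy. -/
def copyElem {n L : ℕ} (u : Fin (n * L)) : Fin n := (finProdFinEquiv.symm u).1

/-- The number of the copy `u`. -/
def copyIdx {n L : ℕ} (u : Fin (n * L)) : Fin L := (finProdFinEquiv.symm u).2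

lemma copy_injective {n L : ℕ} (u u' : Fin (n * L)) (h : copyElem u = copyElem u')
    (h' : copyIdx u = copyIdx u') : u = u' :=
  finProdFinEquiv.symm.injective (Prod.ext h h')

lemma copy_surjective {n L : ℕ} (e : Fin n) (k : Fin L) :
    ∃ u : Fin (n * L), copyElem u = e ∧ copyIdx u = k :=
  ⟨finProdFinEquiv (e, k), by simp [copyElem], by simp [copyIdx]⟩

/-- The weighted algorithm with accuracy `6 / N`. -/
noncomputable def weightedAlg {o : OracleKind} (Au : UnweightedAlg o) (N : ℕ) : WeightedAlg o :=
  fun n w => ((Au (n * numCopies N)).samples (N + 1)).map fun ts =>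
    (QueryProgram.weightedProgram N copyElem copyIdx w ts).toTree

section Reduction

variable {o : OracleKind} {Au : UnweightedAlg o}

open Classical in
lemma exists_isCommonIndep_max {V : Type} [Fintype V] (M : Fin 2 → Matroid V) (w : V → ℝ) :
    ∃ I, IsCommonIndep M I ∧ ∀ I', IsCommonIndep M I' → ∑ e ∈ I', w e ≤ ∑ e ∈ I, w e := by
  obtain ⟨I, hI, hmax⟩ := (Finset.univ.filter (IsCommonIndep M)).exists_max_image
    (fun I => ∑ e ∈ I, w e) ⟨∅, by simp [isCommonIndep_empty]⟩
  exact ⟨I, (Finset.mem_filter.1 hI).2, fun I' hI' =>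
    hmax I' (Finset.mem_filter.2 ⟨Finset.mem_univ _, hI'⟩)⟩

/-- The unfolded instance of a class is fixed before sampling, so the trees fail on it
independently. Failures for different classes may be dependent. -/
lemma not_classSolved_le {α : ℝ} {p : ENNReal} (hA : Au.Approximates α p) {N n : ℕ}
    (w : Fin n → ℝ) (M : Fin 2 → Matroid (Fin n)) (hM : IsInstance M) (s j : ℕ) :
    ((Au (n * numCopies N)).samples (N + 1)).toOuterMeasure
      {ts | ¬ ClassSolved α M copyElem copyIdx N w s j ts} ≤ (1 - p) ^ (N + 1) := by
  set M' := unfoldPair M (copyElem (L := numCopies N)) copyIdx (classWeight N w s j)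
  have h1 := hA _ M' (isInstance_unfoldPair hM)
  refine le_trans (le_of_eq ?_) (((Au (n * numCopies N)).toOuterMeasure_samples_le
    {t | IsApproxMaxCard α M' (t.run M')} (N + 1)).trans
      (pow_le_pow_left' ((Au (n * numCopies N)).toOuterMeasure_compl_le h1) _))
  congr 1
  ext ts
  simp [ClassSolved, M']

open Classical in
/-- With high probability, the classes that have not been solved have small weight. -/
lemma unsolved_weight_le {α : ℝ} {p : ENNReal} (hp : 2 / 3 ≤ p) (hA : Au.Approximates α p)
    {N n : ℕ} [NeZero n] (hN : 2 ≤ N) (w : Fin n → ℝ) (hw : ∀ e, 0 < w e)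
    (M : Fin 2 → Matroid (Fin n)) (hM : IsInstance M) {s : ℕ} (hs : s < N) (I : Finset (Fin n)) :
    ((Au (n * numCopies N)).samples (N + 1)).toOuterMeasure
      {ts | ∑ j ∈ Finset.range (topBand (4 * N) w + 2) with
        ¬ ClassSolved α M copyElem copyIdx N w s j ts, ∑ e ∈ I.filter (InClass N w s j), w e ≤
          (∑ e ∈ I, w e) / N}ᶜ ≤ 1 - p := by
  have hN' : 0 < N := by omega
  have hN0 : (0 : ℝ) < N := by exact_mod_cast hN'
  set μ := (Au (n * numCopies N)).samples (N + 1)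
  set J := Finset.range (topBand (4 * N) w + 2)
  set a : ℕ → ℝ := fun j => ∑ e ∈ I.filter (InClass N w s j), w e with ha
  set A := ∑ e ∈ I, w e
  have ha0 : ∀ j, 0 ≤ a j := fun j => Finset.sum_nonneg fun e _ => (hw e).le
  have hA0 : 0 ≤ A := Finset.sum_nonneg fun e _ => (hw e).le
  have haA : ∑ j ∈ J, a j ≤ A := by
    have h1 := sum_inClass hN' hw hs I
    have h2 : 0 ≤ ∑ e ∈ I.filter (fun e => (weightBand (4 * N) w e + s) % N = 0), w e :=
      Finset.sum_nonneg fun e _ => (hw e).le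
    change ∑ j ∈ J, a j + _ = A at h1
    linarith
  set B := {ts | ∑ j ∈ J with ¬ ClassSolved α M copyElem copyIdx N w s j ts, a j ≤ A / N}ᶜ with hB
  change μ.toOuterMeasure B ≤ 1 - p
  have hBmem : ∀ ts ∈ B, A / N < ∑ j ∈ J with ¬ ClassSolved α M copyElem copyIdx N w s j ts,
      a j := fun ts hts => not_le.1 hts
  -- Markov's inequality needs a positive threshold `A / N`; for `A = 0` the bad event is empty.
  rcases hA0.eq_or_lt with hA1 | hA1
  · have : B = ∅ := by
      rw [Set.eq_empty_iff_forall_notMem]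
      intro ts hts
      have h1 := hBmem ts hts
      have h2 := Finset.sum_le_sum_of_subset_of_nonneg
        (Finset.filter_subset (fun j => ¬ ClassSolved α M copyElem copyIdx N w s j ts) J)
        fun j _ _ => ha0 j
      rw [← hA1, zero_div] at h1
      linarith
    simp [this]
  · have h1 := μ.mul_toOuterMeasure_le J (fun j => ENNReal.ofReal (a j))
      (fun j => {ts | ¬ ClassSolved α M copyElem copyIdx N w s j ts}) (ENNReal.ofReal (A / N)) B
      (fun ts hts => by
        rw [← ENNReal.ofReal_sum_of_nonneg fun j _ => ha0 j]
        refine ENNReal.ofReal_le_ofReal ?_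
        exact (hBmem ts hts).le.trans_eq (by congr))
    have h2 : ∑ j ∈ J, ENNReal.ofReal (a j) *
        μ.toOuterMeasure {ts | ¬ ClassSolved α M copyElem copyIdx N w s j ts} ≤
        ENNReal.ofReal (A / N) * (N * (1 - p) ^ (N + 1)) := by
      calc _ ≤ ∑ j ∈ J, ENNReal.ofReal (a j) * (1 - p) ^ (N + 1) :=
            Finset.sum_le_sum fun j _ => mul_le_mul_right (not_classSolved_le hA w M hM s j) _
        _ = ENNReal.ofReal (∑ j ∈ J, a j) * (1 - p) ^ (N + 1) := by
            rw [← Finset.sum_mul, ENNReal.ofReal_sum_of_nonneg fun j _ => ha0 j]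
        _ ≤ ENNReal.ofReal (A / N * N) * (1 - p) ^ (N + 1) := by
            rw [div_mul_cancel₀ _ hN0.ne']
            exact mul_le_mul_left (ENNReal.ofReal_le_ofReal haA) _
        _ = _ := by
            rw [ENNReal.ofReal_mul (by positivity), ENNReal.ofReal_natCast, mul_assoc]
    have h3 : μ.toOuterMeasure B ≤ N * (1 - p) ^ (N + 1) :=
      (ENNReal.mul_le_mul_iff_right (ENNReal.ofReal_pos.2 (by positivity)).ne'
        ENNReal.ofReal_ne_top).1 (h1.trans h2)
    refine h3.trans (ENNReal.mul_pow_succ_le_self ?_ N)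
    refine (tsub_le_tsub_left hp 1).trans ?_
    rw [tsub_le_iff_right, ENNReal.div_add_div_same]
    norm_num
    rw [ENNReal.div_self (by norm_num) (by norm_num)]

lemma weightedAlg_approximates {α : ℝ} {p : ENNReal} (hα : 0 ≤ α) (hp : 2 / 3 ≤ p)
    (hA : Au.Approximates α p) {N n : ℕ} [NeZero n] (hN6 : 6 ≤ N) {ε : ℝ} (hε : 6 / (N : ℝ) ≤ ε)
    (w : Fin n → ℝ) (hw : ∀ e, 0 < w e) (M : Fin 2 → Matroid (Fin n)) (hM : IsInstance M) :
    p ≤ (weightedAlg Au N n w).toOuterMeasure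
      {t | IsApproxMaxWeight (α * (1 - ε)) M w (t.run M)} := by
  classical
  have hN : 2 ≤ N := by omega
  have h6 : 0 ≤ 1 - 6 / (N : ℝ) := by
    rw [sub_nonneg, div_le_one (by exact_mod_cast (by omega : 0 < N))]
    exact_mod_cast hN6
  obtain ⟨I, hI, hmax⟩ := exists_isCommonIndep_max M w
  obtain ⟨s, hs, hdel⟩ := exists_shift (by omega : 0 < N) hw I
  have hp1 : p ≤ 1 := (hA n M hM).trans (PMF.toOuterMeasure_le_one _ _)
  have hbad := unsolved_weight_le hp hA hN w hw M hM hs I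
  rw [weightedAlg, PMF.toOuterMeasure_map_apply]
  set μ := (Au (n * numCopies N)).samples (N + 1)
  have hgood : p ≤ μ.toOuterMeasure {ts | ∑ j ∈ Finset.range (topBand (4 * N) w + 2) with
      ¬ ClassSolved α M copyElem copyIdx N w s j ts, ∑ e ∈ I.filter (InClass N w s j), w e ≤
        (∑ e ∈ I, w e) / N} := by
    rw [← ENNReal.sub_sub_cancel ENNReal.one_ne_top hp1]
    refine (tsub_le_tsub_left hbad 1).trans (tsub_le_iff_right.2 ?_)
    rw [PMF.toOuterMeasure_add_compl]
  refine hgood.trans (PMF.toOuterMeasure_mono _ ?_)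
  rintro ts ⟨hts, -⟩
  obtain ⟨h1, h2⟩ := weightedProgram_spec M hM hN copy_injective copy_surjective hw ts hα hs I hI
    hdel hts
  simp only [Set.mem_preimage, Set.mem_ofPred_eq, QueryProgram.run_toTree]
  refine ⟨h1, fun I' hI' => le_trans ?_ h2⟩
  have hA0 : 0 ≤ ∑ e ∈ I', w e := Finset.sum_nonneg fun e _ => (hw e).le
  calc α * (1 - ε) * ∑ e ∈ I', w e ≤ α * (1 - 6 / N) * ∑ e ∈ I', w e := by gcongr
    _ ≤ α * (1 - 6 / N) * ∑ e ∈ I, w e :=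
        mul_le_mul_of_nonneg_left (hmax I' hI') (mul_nonneg hα h6)

lemma weightedAlg_numQueries_le {T : ℕ → ℕ → ℝ}
    (hmono : ∀ n n' r r' : ℕ, n ≤ n' → r ≤ r' → T n r ≤ T n' r') (hT : Au.QueriesAtMost T)
    {N n : ℕ} [NeZero n] (hN : 0 < N) (hT1 : ∀ r, 1 ≤ T (n * numCopies N) r)
    (w : Fin n → ℝ) (hw : ∀ e, 0 < w e) (M : Fin 2 → Matroid (Fin n)) (hM : IsInstance M)
    {t : QueryTree (Fin n) o} (ht : t ∈ (weightedAlg Au N n w).support) :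
    (t.numQueries M : ℝ) ≤ (12 * ((N ^ 2 * numCopies N : ℕ) : ℝ) *
      T (n * numCopies N) (2 * numCopies N * commonRank M) +
        20 * ((N * numCopies N : ℕ) : ℝ) ^ 3 * commonRank M) *
          (1 + Real.log (weightRatio w)) := by
  rw [weightedAlg, PMF.mem_support_map_iff] at ht
  obtain ⟨ts, hts, rfl⟩ := ht
  obtain ⟨hlen, hsup⟩ := PMF.mem_support_samples _ _ hts
  rw [QueryProgram.numQueries_toTree]
  have hL := numCopies_pos hN
  set r := commonRank M
  set T₀ := T (n * numCopies N) (2 * numCopies N * r)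
  have hT₀ : 1 ≤ T₀ := hT1 _
  have hcost := weightedProgram_cost_le M hM hN copy_injective hw ts ⌊T₀⌋₊ fun s j t ht => by
    classical
    refine Nat.le_floor ((hT _ _ (isInstance_unfoldPair hM) t (hsup t ht)).trans ?_)
    refine hmono _ _ _ _ le_rfl ?_
    refine Finset.sup_le fun S hS => ?_
    exact card_copies_le_commonRank M hM hL copy_injective (classWeight_le hN hw s j) S
      (Finset.mem_filter.1 hS).2
  rw [hlen] at hcost
  have hD := topBand_le_log (b := 4 * N) (by omega) hw
  set D := topBand (4 * N) w
  have hN1 : (1 : ℝ) ≤ N := by exact_mod_cast hN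
  set L : ℝ := (numCopies N : ℝ)
  have hL1 : (1 : ℝ) ≤ L := Nat.one_le_cast.2 hL
  -- The two verification queries are absorbed because `T₀ ≥ 1`; this is what `one_le_bound` is for.
  have hc : (⌊T₀⌋₊ : ℝ) + 2 ≤ 3 * T₀ := by
    have := Nat.floor_le (by linarith : 0 ≤ T₀)
    linarith
  have hD2 : (D : ℝ) + 2 ≤ 2 * (1 + Real.log (weightRatio w)) := by
    have : (0 : ℝ) ≤ D := Nat.cast_nonneg D
    linarith
  have hr : (0 : ℝ) ≤ r := Nat.cast_nonneg r
  have hNL : (1 : ℝ) ≤ N * L := by nlinarith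
  have hNL3 : (N : ℝ) * L * (N * L + 1) * (4 * L * r) + 2 * r ≤ 10 * N ^ 2 * L ^ 3 * r := by
    have h1 : (N : ℝ) * L * (N * L + 1) * (4 * L) ≤ N * L * (2 * (N * L)) * (4 * L) := by
      gcongr
      linarith
    have h2 : (1 : ℝ) ≤ N ^ 2 * L ^ 3 := one_le_mul_of_one_le_of_one_le
      (one_le_pow₀ hN1) (one_le_pow₀ hL1)
    nlinarith [mul_le_mul_of_nonneg_right h1 hr, mul_le_mul_of_nonneg_right h2 hr]
  have hbr : L * ((N + 1) * (⌊T₀⌋₊ + 2)) + (N * L * (N * L + 1) * (4 * L * r)) + 2 * r ≤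
      6 * N * L * T₀ + 10 * N ^ 2 * L ^ 3 * r := by
    have h1 : L * ((N + 1) * (⌊T₀⌋₊ + 2)) ≤ L * ((2 * N) * (3 * T₀)) := by
      gcongr
      linarith
    linarith
  calc ((QueryProgram.weightedProgram N copyElem copyIdx w ts).cost M : ℝ)
      ≤ N * ((D + 2) * ((L * ((N + 1) * (⌊T₀⌋₊ + 2)) +
          (N * L * (N * L + 1) * (4 * L * r))) + 2 * r)) := by
        have := (Nat.cast_le (α := ℝ)).2 hcost
        simpa [QueryProgram.auctionLength, L] using this
    _ ≤ N * ((2 * (1 + Real.log (weightRatio w))) * (6 * N * L * T₀ +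
          10 * N ^ 2 * L ^ 3 * r)) := by
        refine mul_le_mul_of_nonneg_left (mul_le_mul hD2 hbr (by positivity) ?_) (by positivity)
        have : (0 : ℝ) ≤ D := Nat.cast_nonneg D
        linarith
    _ ≤ (12 * (N ^ 2 * L) * T₀ + 20 * (N * L) ^ 3 * r) * (1 + Real.log (weightRatio w)) := by
        refine le_of_eq ?_
        ring
    _ = _ := by push_cast; rfl

lemma two_mul_sq_numCopies_le_gammaEps {ε : ℝ} (hε : 0 < ε) (hε1 : ε < 1) :
    2 * (⌈6 / ε⌉₊ * numCopies ⌈6 / ε⌉₊) ^ 2 ≤ gammaEps (ε / 42) := by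
  set N := ⌈6 / ε⌉₊ with hN
  have hN7 : (N : ℝ) ≤ 7 / ε := by
    have h1 := Nat.ceil_lt_add_one (a := 6 / ε) (by positivity)
    have h2 : 1 ≤ 1 / ε := by rw [le_div_iff₀ hε]; linarith
    have h3 : 7 / ε = 6 / ε + 1 / ε := by ring
    linarith
  have hN1 : 1 ≤ N := Nat.one_le_ceil_iff.2 (by positivity)
  have hN6 : 6 ≤ N := by
    have h1 : (6 : ℝ) ≤ N := by
      refine le_trans ?_ (Nat.le_ceil (6 / ε))
      rw [le_div_iff₀ hε]
      linarith
    exact_mod_cast h1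
  -- This form matches `gammaEps (ε / 42)`: from `N ≤ 7 / ε`, both the base `4 * N` and the exponent
  -- `6 * N` are at most `42 / ε`.
  have h1 : 2 * (N * numCopies N) ^ 2 ≤ (4 * N) ^ (6 * N) := by
    calc 2 * (N * numCopies N) ^ 2 = 2 * N ^ 4 * (4 * N) ^ (2 * N) := by
          unfold numCopies
          ring
      _ ≤ (4 * N) ^ 5 * (4 * N) ^ (2 * N) := by
          refine Nat.mul_le_mul_right _ ?_
          calc 2 * N ^ 4 ≤ (4 * N) * (4 * N) ^ 4 := by
                refine Nat.mul_le_mul (by omega) (Nat.pow_le_pow_left (by omega) _)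
            _ = _ := by ring
      _ = (4 * N) ^ (5 + 2 * N) := (pow_add _ _ _).symm
      _ ≤ _ := Nat.pow_le_pow_right (by omega) (by omega)
  refine h1.trans ?_
  have h2 : (((4 * N) ^ (6 * N) : ℕ) : ℝ) ≤ (1 / (ε / 42)) ^ (1 / (ε / 42)) := by
    have e1 : 1 / (ε / 42) = 42 / ε := by field_simp
    have h3 : (1 : ℝ) ≤ 42 / ε := by rw [le_div_iff₀ hε]; linarith
    have e2 : 42 / ε = 6 * (7 / ε) := by ring
    rw [e1]
    calc (((4 * N) ^ (6 * N) : ℕ) : ℝ) = (4 * (N : ℝ)) ^ ((6 * N : ℕ) : ℝ) := by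
          rw [Real.rpow_natCast]
          push_cast
          ring
      _ ≤ (42 / ε) ^ ((6 * N : ℕ) : ℝ) := by
          refine Real.rpow_le_rpow (by positivity) ?_ (by positivity)
          have : 0 < 7 / ε := by positivity
          linarith
      _ ≤ _ := by
          refine Real.rpow_le_rpow_of_exponent_le h3 ?_
          push_cast
          linarith
  have h4 := h2.trans (Nat.le_ceil _)
  exact_mod_cast h4

lemma log_weightRatio_nonneg {n : ℕ} (w : Fin n → ℝ) (hw : ∀ e, 0 < w e) :
    0 ≤ Real.log (weightRatio w) := by
  rcases n.eq_zero_or_pos with rfl | hn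
  · simp [weightRatio]
  · have : Nonempty (Fin n) := ⟨⟨0, hn⟩⟩
    exact Real.log_nonneg (one_le_weightRatio hw)

end Reduction

/-! ### Assembling the bounds -/

theorem mainTheorem1 :
    ∃ C : ℝ, 1 ≤ C ∧
      ∀ (ε α : ℝ) (p : ENNReal), 0 < ε → 0 < α → α ≤ 1 → 2 / 3 ≤ p →
      ∀ (T : ℕ → ℕ → ℝ),
        (∀ n n' r r' : ℕ, n ≤ n' → r ≤ r' → T n r ≤ T n' r') →
      ∀ (o : OracleKind) (Au : UnweightedAlg o),
        Au.Approximates α p → Au.QueriesAtMost T →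
      ∃ Aw : WeightedAlg o,
        Aw.Approximates (α * (1 - ε)) p ∧
        (Aw.QueriesAtMost fun n r W =>
          C * ((gammaEps (ε / C) : ℝ) * T (n * gammaEps (ε / C)) (r * gammaEps (ε / C))
              + (gammaEps (ε / C) : ℝ) ^ 3 * (r : ℝ) / ε ^ 3) * (1 + Real.log W)) ∧
        ((∀ k n r : ℕ, 1 ≤ k → (k : ℝ) * T n r ≤ T (k * n) (k * r)) →
          Aw.QueriesAtMost fun n r W =>
            C * (T (n * gammaEps (ε / C)) (r * gammaEps (ε / C))
                + (gammaEps (ε / C) : ℝ) ^ 3 * (r : ℝ) / ε ^ 3) * (1 + Real.log W)) ∧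
        ((∀ n, (Au n).IsDeterministic) → ∀ n w, (Aw n w).IsDeterministic) := by
  classical
  refine ⟨42, by norm_num, ?_⟩
  intro ε α p hε hα hα1 hp T hmono o Au hA hT
  have hTnn := UnweightedAlg.bound_nonneg hT hmono
  set γ := gammaEps (ε / 42) with hγ
  set N := ⌈6 / ε⌉₊ with hN
  have hp1 : p ≤ 1 := (hA 0 (fun _ => Matroid.loopyOn Set.univ) fun _ => rfl).trans
    (PMF.toOuterMeasure_le_one _ _)
  have hcase : ∀ n : ℕ, ¬ (n = 0 ∨ 1 ≤ ε) → 0 < n ∧ ε < 1 := by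
    intro n h
    rw [not_or, not_le] at h
    exact ⟨Nat.pos_of_ne_zero h.1, h.2⟩
  have hquery : ∀ (n : ℕ) (w : Fin n → ℝ) (M : Fin 2 → Matroid (Fin n)), (∀ e, 0 < w e) →
      IsInstance M → ∀ (K : ℝ), 0 ≤ K →
      (0 < n → ε < 1 → ((N ^ 2 * numCopies N : ℕ) : ℝ) *
        T (n * numCopies N) (2 * numCopies N * commonRank M) ≤ K) →
      -- In the degenerate cases the empty set is good enough: there are no elements, or the
      -- required ratio `α * (1 - ε)` is not positive.
      ∀ t ∈ (if n = 0 ∨ 1 ≤ ε then PMF.pure (.output ∅) else weightedAlg Au N n w).support,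
        (t.numQueries M : ℝ) ≤ 42 * (K + (γ : ℝ) ^ 3 * (commonRank M : ℝ) / ε ^ 3) *
          (1 + Real.log (weightRatio w)) := by
    intro n w M hw hM K hK hKT t ht
    have hlog := log_weightRatio_nonneg w hw
    split_ifs at ht with h
    · rw [PMF.mem_support_pure_iff] at ht
      rw [ht]
      simp only [QueryTree.numQueries, Nat.cast_zero]
      positivity
    · obtain ⟨hn, hε1⟩ := hcase n h
      have : NeZero n := ⟨hn.ne'⟩
      have hN0 : 0 < N := Nat.ceil_pos.2 (by positivity)
      have h1 := weightedAlg_numQueries_le hmono hT hN0 (fun r =>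
        UnweightedAlg.one_le_bound hα hp hA hT hmono (Nat.mul_pos hn (numCopies_pos hN0)) r)
        w hw M hM ht
      refine h1.trans (mul_le_mul_of_nonneg_right ?_ (by linarith))
      have h2 := hKT hn hε1
      have h3 : N * numCopies N ≤ γ := by
        refine le_trans ?_ (two_mul_sq_numCopies_le_gammaEps hε hε1)
        nlinarith [Nat.mul_pos hN0 (numCopies_pos hN0)]
      have h4 : ((N * numCopies N : ℕ) : ℝ) ^ 3 * commonRank M ≤
          (γ : ℝ) ^ 3 * (commonRank M : ℝ) / ε ^ 3 := by
        rw [le_div_iff₀ (by positivity)]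
        calc ((N * numCopies N : ℕ) : ℝ) ^ 3 * commonRank M * ε ^ 3
            ≤ ((N * numCopies N : ℕ) : ℝ) ^ 3 * commonRank M * 1 := by
              gcongr
              exact pow_le_one₀ hε.le hε1.le
          _ ≤ (γ : ℝ) ^ 3 * (commonRank M : ℝ) := by
              rw [mul_one]
              gcongr
      have h5 : 0 ≤ (γ : ℝ) ^ 3 * (commonRank M : ℝ) / ε ^ 3 := by positivity
      linarith
  refine ⟨fun n w => if n = 0 ∨ 1 ≤ ε then PMF.pure (.output ∅) else weightedAlg Au N n w,
    ?_, ?_, ?_, ?_⟩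
  · intro n w M hw hM
    dsimp only
    split_ifs with h
    · rw [PMF.toOuterMeasure_pure_apply, if_pos]
      · exact hp1
      · refine ⟨isCommonIndep_empty M, fun I _ => ?_⟩
        simp only [QueryTree.run, Finset.sum_empty]
        rcases h with rfl | h
        · rw [Finset.eq_empty_of_isEmpty I]
          simp
        · exact mul_nonpos_of_nonpos_of_nonneg (mul_nonpos_of_nonneg_of_nonpos hα.le (by linarith))
            (Finset.sum_nonneg fun e _ => (hw e).le)
    · obtain ⟨hn, hε1⟩ := hcase n h
      have : NeZero n := ⟨hn.ne'⟩
      have h6 : 6 / ε ≤ N := Nat.le_ceil _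
      have hN6 : 6 ≤ N := by
        have : (6 : ℝ) ≤ N := by
          refine le_trans ?_ h6
          rw [le_div_iff₀ hε]
          linarith
        exact_mod_cast this
      refine weightedAlg_approximates hα.le hp hA hN6 ?_ w hw M hM
      rw [div_le_iff₀ (by positivity)]
      rwa [div_le_iff₀' hε] at h6
  · intro n w M hw hM t ht
    refine hquery n w M hw hM _ (mul_nonneg (Nat.cast_nonneg _) (hTnn _ _)) ?_ t ht
    intro hn hε1
    have h2 := two_mul_sq_numCopies_le_gammaEps hε hε1
    rw [← hN, ← hγ] at h2
    have hL := numCopies_pos (Nat.ceil_pos.2 (by positivity) : 0 < N)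
    have hN0 : 0 < N := Nat.ceil_pos.2 (by positivity)
    have h3 : N ^ 2 * numCopies N ≤ γ := by nlinarith [Nat.mul_pos hN0 hN0]
    have h4 : 2 * numCopies N ≤ γ := by nlinarith [Nat.mul_pos hN0 hN0, Nat.mul_pos hL hL]
    refine mul_le_mul (by exact_mod_cast h3) (hmono _ _ _ _ ?_ ?_) (hTnn _ _) (Nat.cast_nonneg _)
    · exact Nat.mul_le_mul_left _ (by omega)
    · rw [mul_comm]
      exact Nat.mul_le_mul_left _ h4
  · intro hlin n w M hw hM t ht
    refine hquery n w M hw hM _ (hTnn _ _) ?_ t ht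
    intro hn hε1
    have h2 := two_mul_sq_numCopies_le_gammaEps hε hε1
    rw [← hN, ← hγ] at h2
    have hN0 : 0 < N := Nat.ceil_pos.2 (by positivity)
    have hL := numCopies_pos hN0
    -- Linear growth moves the factor `N ^ 2 * numCopies N` into the arguments; the rank argument
    -- then becomes `2 * (N * numCopies N) ^ 2 * r`, which is what `γ` was made to dominate.
    refine (hlin _ _ _ (Nat.mul_pos (pow_pos hN0 2) hL)).trans (hmono _ _ _ _ ?_ ?_)
    · calc N ^ 2 * numCopies N * (n * numCopies N) = n * (N * numCopies N) ^ 2 := by ring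
        _ ≤ n * γ := Nat.mul_le_mul_left _ (by omega)
    · calc N ^ 2 * numCopies N * (2 * numCopies N * commonRank M)
          = commonRank M * (2 * (N * numCopies N) ^ 2) := by ring
        _ ≤ commonRank M * γ := Nat.mul_le_mul_left _ h2
  · intro hdet n w
    dsimp only
    split_ifs with h
    · exact ⟨_, rfl⟩
    · obtain ⟨t, ht⟩ := hdet (n * numCopies N)
      exact ⟨(QueryProgram.weightedProgram N copyElem copyIdx w (List.replicate (N + 1) t)).toTree,
        by rw [weightedAlg, ht, PMF.samples_pure, PMF.pure_map]⟩
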